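/- For every $n\ge 1$ let $\mathbf d_n=((d_x^-,d_x^+))_{x\in[n]}$ be a deterministic bi-degree sequence with $m=m_n=\sum_{x\in[n]}d_x^-=\sum_{x\in[n]}d_x^+$, and suppose that there are constants $C,C'$ such that $2\le d_x^+\le C$ and $2\le d_x^-\le C'$ for all $n$ and all $x\in[n]$. Let $G_n=([n],E)$ be the random directed multigraph sampled from the directed configuration model: each vertex $x$ carries $d_x^+$ out-stubs and $d_x^-$ in-stubs, the out-stubs are matched with the in-stubs by a uniformly random bijection, and each matched pair gives a directed edge from the vertex of its out-stub to the vertex of its in-stub. Let $\mathbb E$ be the expectation over $G_n$. Given $G_n$, let $(\eta_t)_{t\ge0}$ be the voter model on $G_n$, i.e. the continuous-time Markov process on $\{0,1\}^{[n]}$ with generator $$(\mathcal Lf)(\eta)=\sum_{(x,y)\in E}\frac1{d_x^+}\big(f(\eta^{x\to y})-f(\eta)\big),$$ where the sum runs over the edges with multiplicity, $\eta^{x\to y}(x)=\eta(y)$, and $\eta^{x\to y}(z)=\eta(z)$ for $z\ne x$. For $u\in(0,1)$ let $\mathbf E_u$ be its expectation when $\eta_0$ has law $\mathrm{Bern}(u)^{\otimes[n]}$,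 and let $$\mathcal D_t=\frac{\#\{(x,y)\in E:\eta_t(x)\ne\eta_t(y)\}}{\#E}$$ be the density of discordant edges at time $t$ (edges counted with multiplicity). Put $\delta=\delta_n=\frac mn$, $\rho=\rho_n=\frac1m\sum_{x\in[n]}\frac{d_x^-}{d_x^+}$, let $C_s=\frac1{s+1}\binom{2s}{s}$ be the Catalan numbers, and for $t\ge0$ let $$\varphi(t)=\varphi_n(t)=1-\frac1{2\delta}\sum_{k\ge0}e^{-2t}\frac{(2t)^k}{k!}\Bigg(\mathbf 1_{k>2}\sum_{s=1}^{\lfloor (k-1)/2\rfloor}2^{-2s}C_s\,\rho^s+\mathbf 1_{k>0}\Bigg),\qquad \varphi(\infty)=\varphi_n(\infty)=1-\frac{1-\sqrt{1-\rho}}{\delta\rho}.$$ Fix $u\in(0,1)$, and let $(t_n)$ be a sequence of non-negative real numbers such that $\lim_{n\to\infty}t_n$ exists in $[0,\infty]$ and $t_n=o(\log^3 n)$. Then $$\Big|\mathbb E\big[\mathbf E_u[\mathcal D_{t_n}]\big]-2u(1-u)\,\varphi_n(t_n)\Big|\longrightarrow0\qquad(n\to\infty).$$ Moreover, if $\lim_{n\to\infty}t_n=\infty$,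 then $|\varphi_n(t_n)-\varphi_n(\infty)|\longrightarrow0$. -/

import Mathlib

open Filter Topology Asymptotics
open scoped BigOperators

noncomputable section

/-! ### The voter model on a finite directed multigraph

A finite directed multigraph on `V` is given by a finite type `ε` of edges together with the maps
`src tgt : ε → V`; the edge `e` exits `src e` and enters `tgt e`. -/

namespace VoterModel

variable {V ε : Type*} [Fintype V] [DecidableEq V] [Fintype ε]

/-- The out-degree of `x`: the number of edges (with multiplicity) exiting `x`. -/
def outDegree (src : ε → V) (x : V) : ℕ := (Finset.univ.filter fun e => src e = x).card

/-- The configuration `η^{x → y}`: vertex `x` adopts the opinion of `y`, nothing else changes. -/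
def adopt (η : V → Bool) (x y : V) : V → Bool := Function.update η x (η y)

/-- The generator of the voter model,
`(L f)(η) = ∑_{e = (x, y)} (1 / d_x^+) (f (η^{x → y}) - f η)`. -/
def generator (src tgt : ε → V) : ((V → Bool) → ℝ) →ₗ[ℝ] ((V → Bool) → ℝ) where
  toFun f η := ∑ e, (1 / (outDegree src (src e) : ℝ)) * (f (adopt η (src e) (tgt e)) - f η)
  map_add' f g := by
    funext η
    simp only [Pi.add_apply, ← Finset.sum_add_distrib]
    exact Finset.sum_congr rfl fun e _ => by ring
  map_smul' c f := by
    funext η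
    simp only [Pi.smul_apply, smul_eq_mul, RingHom.id_apply, Finset.mul_sum]
    exact Finset.sum_congr rfl fun e _ => by ring

/-- The Markov semigroup `P_t = exp (t L)` of the voter model: `(semigroup src tgt t f) η` is the
expectation of `f (η_t)` for the process started from `η_0 = η`. -/
def semigroup (src tgt : ε → V) (t : ℝ) :
    ((V → Bool) → ℝ) →L[ℝ] ((V → Bool) → ℝ) :=
  NormedSpace.exp (t • LinearMap.toContinuousLinearMap (generator src tgt))

/-- The mass that the product measure `Bern(u)^{⊗ V}` gives to the configuration `η`. -/
def bernoulliWeight (u : ℝ) (η : V → Bool) : ℝ := ∏ x, if η x then u else 1 - u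

/-- `E_u[f(η_t)]`: the expectation of `f` at time `t` for the voter model with initial
distribution `Bern(u)^{⊗ V}`. -/
def expectation (src tgt : ε → V) (u t : ℝ) (f : (V → Bool) → ℝ) : ℝ :=
  ∑ η, bernoulliWeight u η * semigroup src tgt t f η

/-- The fraction of discordant edges, `#{(x, y) ∈ E : η x ≠ η y} / #E`. -/
def discordantDensity (src tgt : ε → V) (η : V → Bool) : ℝ :=
  ((Finset.univ.filter fun e => η (src e) ≠ η (tgt e)).card : ℝ) / (Fintype.card ε : ℝ)

end VoterModel

/-! ### The directed configuration model -/

/-- A bi-degree sequence on `n` vertices: in- and out-degrees with the same total. -/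
structure BiDegreeSequence (n : ℕ) where
  inDeg : Fin n → ℕ
  outDeg : Fin n → ℕ
  sum_eq : ∑ x, inDeg x = ∑ x, outDeg x

namespace BiDegreeSequence

variable {n : ℕ} (d : BiDegreeSequence n)

/-- The out-stubs: `d_x^+` of them at each vertex `x`. -/
abbrev OutStub : Type := Σ x : Fin n, Fin (d.outDeg x)

/-- The in-stubs: `d_x^-` of them at each vertex `x`. -/
abbrev InStub : Type := Σ x : Fin n, Fin (d.inDeg x)

/-- A configuration is a perfect matching of the out-stubs with the in-stubs. -/
abbrev Configuration : Type := d.OutStub ≃ d.InStub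

/-- The edges of the graph are its out-stubs; this is the vertex that an edge exits. -/
def src (e : d.OutStub) : Fin n := e.1

/-- The vertex that an edge enters, in the graph of the configuration `ω`. -/
def tgt {d : BiDegreeSequence n} (ω : d.Configuration) (e : d.OutStub) : Fin n := (ω e).1

/-- The expectation with respect to the law of the directed configuration model, under which the
configuration is uniformly distributed. -/
def dcmExpectation (F : d.Configuration → ℝ) : ℝ :=
  (∑ ω, F ω) / (Fintype.card d.Configuration : ℝ)

/-- The number of edges `m`. -/
def m : ℕ := ∑ x, d.outDeg x

/-- `δ = m / n`. -/
def delta : ℝ := (d.m : ℝ) / (n : ℝ)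

/-- `ρ = (1 / m) ∑_x d_x^- / d_x^+`. -/
def rho : ℝ := (1 / (d.m : ℝ)) * ∑ x, (d.inDeg x : ℝ) / (d.outDeg x : ℝ)

/-- The function `φ(t)`. For `k = 0` the natural number `(k - 1) / 2` is `0`, so that the inner
sum is empty. -/
def phi (t : ℝ) : ℝ :=
  1 - 1 / (2 * d.delta) * ∑' k : ℕ, Real.exp (-2 * t) * ((2 * t) ^ k / (k.factorial : ℝ)) *
    ((if 2 < k then
        ∑ s ∈ Finset.Icc 1 ((k - 1) / 2), ((2 : ℝ) ^ (2 * s))⁻¹ * (catalan s : ℝ) * d.rho ^ s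
      else 0) + (if 0 < k then 1 else 0))

/-- The limiting value `φ(∞)`. -/
def phiInfty : ℝ := 1 - (1 - √(1 - d.rho)) / (d.delta * d.rho)

/-- Assumption on the degrees: all of them are between `2` and a constant. -/
def DegreesBounded (C C' : ℝ) : Prop :=
  ∀ x, 2 ≤ d.outDeg x ∧ 2 ≤ d.inDeg x ∧ (d.outDeg x : ℝ) ≤ C ∧ (d.inDeg x : ℝ) ≤ C'

theorem rho_nonneg : 0 ≤ d.rho := by
  unfold rho
  positivity

theorem rho_le_one {C C' : ℝ} (h : d.DegreesBounded C C') : d.rho ≤ 1 := by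
  unfold rho
  have h1 : ∑ x, (d.inDeg x : ℝ) / (d.outDeg x : ℝ) ≤ (d.m : ℝ) := by
    rw [m, ← d.sum_eq, Nat.cast_sum]
    refine Finset.sum_le_sum fun x _ => div_le_self (by positivity) ?_
    have := (h x).1
    exact_mod_cast (by omega : 1 ≤ d.outDeg x)
  rw [one_div, inv_mul_eq_div]
  exact div_le_one_of_le₀ h1 (by positivity)

/-- The series in the definition of `φ(t)` converges. -/
theorem summable_phi {C C' : ℝ} (h : d.DegreesBounded C C') {t : ℝ} (ht : 0 ≤ t) :
    Summable fun k : ℕ => Real.exp (-2 * t) * ((2 * t) ^ k / (k.factorial : ℝ)) *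
    ((if 2 < k then
        ∑ s ∈ Finset.Icc 1 ((k - 1) / 2), ((2 : ℝ) ^ (2 * s))⁻¹ * (catalan s : ℝ) * d.rho ^ s
      else 0) + (if 0 < k then 1 else 0)) := by
  have h0 := d.rho_nonneg
  have h1 := d.rho_le_one h
  have hterm : ∀ s : ℕ, ((2 : ℝ) ^ (2 * s))⁻¹ * (catalan s : ℝ) * d.rho ^ s ≤ 1 := by
    intro s
    have hc : (catalan s : ℝ) ≤ 2 ^ (2*s) := by
      have : catalan s ≤ 2 ^ (2*s) := by
        rw [catalan_eq_centralBinom_div]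
        refine (Nat.div_le_self _ _).trans ?_
        rw [Nat.centralBinom]
        exact Nat.choose_le_two_pow _ _
      exact_mod_cast this
    have : ((2 : ℝ) ^ (2 * s))⁻¹ * (catalan s : ℝ) ≤ 1 := by
      rw [inv_mul_le_iff₀ (by positivity)]; simpa using hc
    exact mul_le_one₀ this (by positivity) (pow_le_one₀ h0 h1)
  refine Summable.of_nonneg_of_le (fun k => ?_) (fun k => ?_) ((Real.summable_pow_div_factorial (4*t)).mul_left (Real.exp (-2*t)))
  · have : 0 ≤ ∑ s ∈ Finset.Icc 1 ((k - 1) / 2), ((2 : ℝ) ^ (2 * s))⁻¹ * (catalan s : ℝ) * d.rho ^ s := by positivity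
    apply mul_nonneg (by positivity)
    split_ifs <;> linarith
  · have hs : ∑ s ∈ Finset.Icc 1 ((k - 1) / 2), ((2 : ℝ) ^ (2 * s))⁻¹ * (catalan s : ℝ) * d.rho ^ s ≤ k := by
      refine (Finset.sum_le_sum fun s _ => hterm s).trans ?_
      simp
      exact_mod_cast (by omega : (k-1)/2 ≤ k)
    have hk : (k : ℝ) + 1 ≤ 2 ^ k := by exact_mod_cast Nat.lt_two_pow_self
    have hk0 : (0:ℝ) ≤ k := by positivity
    have : (4 * t) ^ k / (k.factorial : ℝ) = ((2 * t) ^ k / (k.factorial : ℝ)) * 2 ^ k := by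
      rw [show 4 * t = (2*t) * 2 by ring, mul_pow]; ring
    rw [this, ← mul_assoc]
    gcongr
    split_ifs <;> linarith

/-- `𝔼[E_u[D_t]]`: the expectation, over the directed configuration model, of the expected
fraction of discordant edges at time `t` of the voter model started from `Bern(u)^{⊗ [n]}`. -/
def annealedDiscordance (u t : ℝ) : ℝ :=
  d.dcmExpectation fun ω =>
    VoterModel.expectation d.src (tgt ω) u t (VoterModel.discordantDensity d.src (tgt ω))

end BiDegreeSequence

end

/-! The voter model is dual to coalescing random walks: run backwards in time, the opinions of `x`
and `y` are those of the starting points of two walks issued from `x` and `y`, so that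
`E_u[1{η_t x ≠ η_t y}]` is `2 u (1 - u)` times the probability that the two walks have not met by
time `t`. Here this is read off from the algebra of the generator `L`: the span of the disagreement
indicators is stable under `1 + L / 2`, which acts on it as the jump chain of the two walks
(`VoterModel.functional_jumpOp_pow`), and `exp (t L)` is a Poissonian average of the powers of
`1 + L / 2` (`VoterModel.hasSum_expectation_discordantDensity`).

It remains to find the probability that the walks issued from the two ends of a uniform edge meet
within `k` jumps, averaged over the matching. The matching is revealed along the walks: conditioning
on the matches of a set `D` of out-stubs is the operator `condAvg D`, and the next match is uniform
among the remaining in-stubs (`condAvg_apply`). Up to a probability of order `k ^ 2 / m`, every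
newly revealed vertex is one of which nothing has been revealed before. On this event the rear walk, which
starts by having the edge to the front walk ahead of it, can meet the front walk only by following
its trail. Once it has left the trail, the walks do not meet (`condAvg_meetProb_le_of_ne`). An edge
that the front walk adds to the trail is taken by the rear walk with probability `ρ` on average,
since the vertex it issues from is sampled proportionally to its in-degree. The length of the
trail is therefore a walk on `ℕ` that goes up with weight `ρ / 2` and down with weight `1 / 2`
(`abs_condAvg_meetProb_sub_le`), and the first edge contributes the factor `1 / δ`.

The first passage probabilities of this walk are given by the Catalan generating function
(`hitProb_eq_sum`), and this is the bracket in `φ`. As the second moment of the Poisson law of mean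
`2 t` is of order `1 + t ^ 2`, the error is of order `(1 + t ^ 2) / n`. Finally the partial sums of
the Catalan series at `ρ / 4 ≤ 1 / 8` converge geometrically to the closed form in `φ(∞)`, and a
Poissonian average of a geometric sequence tends to `0` as `t → ∞`. -/

/-! ### Duality with coalescing walks -/

namespace VoterModel

variable {V ε : Type*} [DecidableEq V] [Fintype ε]

/-- The average over the out-neighbours `z` of `x`, with multiplicity, of `h z`; more generally `h`
may depend on the edge by which `x` is left. -/
noncomputable def outAverage (src : ε → V) (x : V) (h : ε → ℝ) : ℝ :=
  ∑ e with src e = x, 1 / (outDegree src x : ℝ) * h e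

/-- The probability that two independent walks started at `x` and `y` have met within the first `k`
jumps of the pair, where at each jump one of the two walks, chosen by a fair coin, moves along a
uniform out-edge. -/
noncomputable def meetProb (src tgt : ε → V) : ℕ → V → V → ℝ
  | 0, x, y => if x = y then 1 else 0
  | k + 1, x, y => if x = y then 1 else
      2⁻¹ * outAverage src x (fun e => meetProb src tgt k (tgt e) y) +
        2⁻¹ * outAverage src y (fun e => meetProb src tgt k x (tgt e))

/-- The indicator of a disagreement between `x` and `y`. -/
def disagree (x y : V) (η : V → Bool) : ℝ := if η x ≠ η y then 1 else 0

variable {src tgt : ε → V}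

theorem outAverage_const {x : V} (hx : outDegree src x ≠ 0) (c : ℝ) :
    outAverage src x (fun _ => c) = c := by
  have : (outDegree src x : ℝ) ≠ 0 := by exact_mod_cast hx
  rw [outAverage, Finset.sum_const, nsmul_eq_mul]
  change (outDegree src x : ℝ) * _ = c
  field_simp

theorem outAverage_sub (x : V) (f g : ε → ℝ) :
    outAverage src x (fun e => f e - g e) = outAverage src x f - outAverage src x g := by
  simp only [outAverage, mul_sub, Finset.sum_sub_distrib]

theorem outAverage_mono (x : V) {f g : ε → ℝ} (h : ∀ e, src e = x → f e ≤ g e) :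
    outAverage src x f ≤ outAverage src x g := by
  refine Finset.sum_le_sum fun e he => ?_
  exact mul_le_mul_of_nonneg_left (h e (Finset.mem_filter.1 he).2) (by positivity)

theorem meetProb_self (k : ℕ) (x : V) : meetProb src tgt k x x = 1 := by
  cases k <;> simp [meetProb]

theorem meetProb_symm (k : ℕ) (x y : V) : meetProb src tgt k x y = meetProb src tgt k y x := by
  induction k generalizing x y with
  | zero => simp [meetProb, eq_comm]
  | succ k ih =>
    simp only [meetProb, eq_comm (a := x)]
    rw [add_comm]
    simp only [ih x, ih _ y]

theorem meetProb_nonneg (k : ℕ) (x y : V) : 0 ≤ meetProb src tgt k x y := by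
  induction k generalizing x y with
  | zero => rw [meetProb]; positivity
  | succ k ih =>
    rw [meetProb]
    have h1 : 0 ≤ outAverage src x (fun e => meetProb src tgt k (tgt e) y) :=
      Finset.sum_nonneg fun e _ => mul_nonneg (by positivity) (ih _ _)
    have h2 : 0 ≤ outAverage src y (fun e => meetProb src tgt k x (tgt e)) :=
      Finset.sum_nonneg fun e _ => mul_nonneg (by positivity) (ih _ _)
    positivity

theorem outAverage_le_one (x : V) {f : ε → ℝ} (h : ∀ e, f e ≤ 1) : outAverage src x f ≤ 1 := by
  by_cases hx : outDegree src x = 0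
  · simp [outAverage, hx]
  · exact (outAverage_mono x fun e _ => h e).trans_eq (outAverage_const hx 1)

theorem meetProb_le_one (k : ℕ) (x y : V) : meetProb src tgt k x y ≤ 1 := by
  induction k generalizing x y with
  | zero => rw [meetProb]; split_ifs <;> norm_num
  | succ k ih =>
    rw [meetProb]
    have h1 := outAverage_le_one (src := src) x (fun e => ih (tgt e) y)
    have h2 := outAverage_le_one (src := src) y (fun e => ih x (tgt e))
    split_ifs <;> linarith

theorem disagree_adopt_left {x y z : V} (h : x ≠ y) (η : V → Bool) :
    disagree x y (adopt η x z) = disagree z y η := by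
  simp [disagree, adopt, Function.update_of_ne h.symm]

theorem disagree_adopt_right {x y z : V} (h : x ≠ y) (η : V → Bool) :
    disagree x y (adopt η y z) = disagree x z η := by
  simp [disagree, adopt, Function.update_of_ne h]

theorem disagree_adopt_of_ne {x y w z : V} (hx : w ≠ x) (hy : w ≠ y) (η : V → Bool) :
    disagree x y (adopt η w z) = disagree x y η := by
  simp [disagree, adopt, Function.update_of_ne hx.symm, Function.update_of_ne hy.symm]

/-- The voter generator acts on the disagreement indicators as the generator of two walks that stay
together once they have met. -/
theorem generator_disagree {x y : V} (h : x ≠ y) (hx : outDegree src x ≠ 0)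
    (hy : outDegree src y ≠ 0) (η : V → Bool) :
    generator src tgt (disagree x y) η =
      outAverage src x (fun e => disagree (tgt e) y η) +
        outAverage src y (fun e => disagree x (tgt e) η) - 2 * disagree x y η := by
  have key : generator src tgt (disagree x y) η =
      outAverage src x (fun e => disagree (tgt e) y η - disagree x y η) +
        outAverage src y (fun e => disagree x (tgt e) η - disagree x y η) := by
    simp only [generator, LinearMap.coe_mk, AddHom.coe_mk, outAverage, Finset.sum_filter]
    rw [← Finset.sum_add_distrib]
    refine Finset.sum_congr rfl fun e _ => ?_
    by_cases h1 : src e = x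
    · have h2 : src e ≠ y := fun h2 => h (h1.symm.trans h2)
      rw [if_pos h1, if_neg h2, h1, disagree_adopt_left h, add_zero]
    · by_cases h2 : src e = y
      · rw [if_pos h2, if_neg h1, h2, disagree_adopt_right h, zero_add]
      · rw [if_neg h1, if_neg h2, disagree_adopt_of_ne h1 h2]; simp
  rw [key, outAverage_sub, outAverage_sub, outAverage_const hx, outAverage_const hy]
  ring

omit [DecidableEq V] in
theorem discordantDensity_eq (src tgt : ε → V) : discordantDensity src tgt =
    (Fintype.card ε : ℝ)⁻¹ • ∑ e, disagree (src e) (tgt e) := by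
  funext η
  simp only [discordantDensity, disagree, Pi.smul_apply, Finset.sum_apply, smul_eq_mul,
    Finset.sum_boole, div_eq_inv_mul]

section Semigroup

variable [Fintype V]

/-- The transition operator `1 + L / 2` of the jump chain of a rate-two process with generator
`L`. -/
noncomputable def jumpOp (src tgt : ε → V) : ((V → Bool) → ℝ) →L[ℝ] ((V → Bool) → ℝ) :=
  1 + (2⁻¹ : ℝ) • LinearMap.toContinuousLinearMap (generator src tgt)

theorem jumpOp_disagree {x y : V} (h : x ≠ y) (hx : outDegree src x ≠ 0)
    (hy : outDegree src y ≠ 0) :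
    jumpOp src tgt (disagree x y) =
      (2⁻¹ : ℝ) • (∑ e with src e = x, (1 / (outDegree src x : ℝ)) • disagree (tgt e) y) +
      (2⁻¹ : ℝ) • (∑ e with src e = y, (1 / (outDegree src y : ℝ)) • disagree x (tgt e)) := by
  funext η
  have h1 : jumpOp src tgt (disagree x y) η =
      disagree x y η + 2⁻¹ * generator src tgt (disagree x y) η := rfl
  rw [h1, generator_disagree h hx hy]
  simp only [Pi.add_apply, Pi.smul_apply, Finset.sum_apply, smul_eq_mul, outAverage]
  ring

/-- Duality for the jump chain: a linear functional sees the `k`-th iterate of the disagreement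
indicator of `x` and `y` through the probability that the walks from `x` and `y` have not met. -/
theorem functional_jumpOp_pow (hdeg : ∀ x, outDegree src x ≠ 0)
    (B : ((V → Bool) → ℝ) →ₗ[ℝ] ℝ) (c : ℝ)
    (hB : ∀ x y, x ≠ y → B (disagree x y) = c) (k : ℕ) (x y : V) :
    B ((jumpOp src tgt ^ k) (disagree x y)) = c * (1 - meetProb src tgt k x y) := by
  have hself : ∀ (k : ℕ) (x : V), (jumpOp src tgt ^ k) (disagree x x) = 0 := by
    intro k x
    have h0 : (disagree x x : (V → Bool) → ℝ) = 0 := by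
      funext η; simp [disagree]
    rw [h0, map_zero]
  induction k generalizing x y with
  | zero =>
    by_cases h : x = y
    · subst h; rw [hself, meetProb_self]; simp
    · simp [meetProb, h, hB x y h]
  | succ k ih =>
    by_cases h : x = y
    · subst h; rw [hself, meetProb_self]; simp
    · rw [pow_succ, mul_apply_eq_comp, jumpOp_disagree h (hdeg x) (hdeg y)]
      simp only [map_add, map_smul, map_sum, ih, meetProb, if_neg h, smul_eq_mul]
      have e1 := outAverage_const (src := src) (hdeg x) 1
      have e2 := outAverage_const (src := src) (hdeg y) 1
      have e3 : ∀ (z : V) (f : ε → ℝ), ∑ e with src e = z, 1 / (outDegree src z : ℝ) *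
          (c * (1 - f e)) = c * outAverage src z (fun e => 1 - f e) := fun z f => by
        rw [outAverage, Finset.mul_sum]
        exact Finset.sum_congr rfl fun e _ => by ring
      rw [e3, e3, outAverage_sub, outAverage_sub, e1, e2]
      ring

theorem sum_bernoulliWeight_mul_disagree (u : ℝ) {x y : V} (h : x ≠ y) :
    ∑ η, bernoulliWeight u η * disagree x y η = 2 * u * (1 - u) := by
  have aux : ∀ a b : Bool, ∑ η : V → Bool, bernoulliWeight u η *
      (if η x = a ∧ η y = b then 1 else 0) =
        (if a then u else 1 - u) * (if b then u else 1 - u) := by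
    intro a b
    have h1 : ∀ η : V → Bool, bernoulliWeight u η * (if η x = a ∧ η y = b then 1 else 0) =
        ∏ z, ((if η z then u else 1 - u) * (if z = x then (if η z = a then 1 else 0) else 1) *
          (if z = y then (if η z = b then 1 else 0) else 1)) := by
      intro η
      rw [Finset.prod_mul_distrib, Finset.prod_mul_distrib, Finset.prod_ite_eq' Finset.univ x,
        Finset.prod_ite_eq' Finset.univ y, bernoulliWeight]
      by_cases ha : η x = a <;> by_cases hb : η y = b <;> simp [ha, hb]
    simp only [h1]
    rw [← Fintype.prod_sum (fun z (j : Bool) => (if j = true then u else 1 - u) *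
      (if z = x then (if j = a then 1 else 0) else 1) *
          (if z = y then (if j = b then (1 : ℝ) else 0) else 1))]
    have h2 : ∀ z : V, ∑ j : Bool, (if j = true then u else 1 - u) *
      (if z = x then (if j = a then 1 else 0) else 1) *
          (if z = y then (if j = b then (1 : ℝ) else 0) else 1) =
          (if z = x then (if a then u else 1 - u) else 1) *
            (if z = y then (if b then u else 1 - u) else 1) := by
      intro z
      by_cases hx : z = x
      · have hy : z ≠ y := fun hy => h (hx.symm.trans hy)
        simp only [hx, h, if_true, if_false]
        cases a <;> simp
      · by_cases hy : z = y
        · simp only [hy, h.symm, if_true, if_false]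
          cases b <;> simp
        · simp [hx, hy]
    simp only [h2]
    rw [Finset.prod_mul_distrib, Finset.prod_ite_eq' Finset.univ x,
        Finset.prod_ite_eq' Finset.univ y]
    simp
  have h3 : ∀ η : V → Bool, bernoulliWeight u η * disagree x y η =
      bernoulliWeight u η * (if η x = true ∧ η y = false then 1 else 0) +
        bernoulliWeight u η * (if η x = false ∧ η y = true then 1 else 0) := by
    intro η
    rw [disagree]
    cases η x <;> cases η y <;> simp
  simp only [h3, Finset.sum_add_distrib, aux]
  simp
  ring

/-- The semigroup is the Poissonization of its jump chain. -/
theorem hasSum_semigroup (src tgt : ε → V) (t : ℝ) :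
    HasSum (fun k : ℕ => (Real.exp (-2 * t) * ((2 * t) ^ k / (k.factorial : ℝ))) •
      jumpOp src tgt ^ k) (semigroup src tgt t) := by
  set L := LinearMap.toContinuousLinearMap (generator src tgt) with hL
  have h1 : t • L = algebraMap ℝ _ (-2 * t) + (2 * t) • jumpOp src tgt := by
    rw [jumpOp, ← hL, smul_add, Algebra.algebraMap_eq_smul_one, smul_smul, ← add_assoc, ← add_smul]
    ring_nf
    simp
  have h2 : semigroup src tgt t =
      Real.exp (-2 * t) • NormedSpace.exp ((2 * t) • jumpOp src tgt) := by
    let _ : NormedAlgebra ℚ (((V → Bool) → ℝ) →L[ℝ] ((V → Bool) → ℝ)) :=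
      NormedAlgebra.restrictScalars ℚ ℝ _
    rw [semigroup, ← hL, h1, NormedSpace.exp_add_of_commute (Algebra.commutes _ _),
      ← NormedSpace.algebraMap_exp_comm, Real.exp_eq_exp_ℝ,
      Algebra.smul_def (NormedSpace.exp (-2 * t))]
  rw [h2]
  have h3 := (NormedSpace.exp_series_hasSum_exp' (𝕂 := ℝ) ((2 * t) • jumpOp src tgt)).const_smul
    (Real.exp (-2 * t))
  refine h3.congr_fun ?_
  intro k
  rw [smul_pow, smul_smul, smul_smul]
  congr 1
  ring

/-- Duality: the expected discordance is a Poissonian average of the probability that the walks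
started from the two ends of a uniform edge have not met. -/
theorem hasSum_expectation_discordantDensity [Nonempty ε] (hdeg : ∀ x, outDegree src x ≠ 0)
    (u t : ℝ) :
    HasSum (fun k : ℕ => Real.exp (-2 * t) * ((2 * t) ^ k / (k.factorial : ℝ)) *
      (2 * u * (1 - u) * (1 - (∑ e, meetProb src tgt k (src e) (tgt e)) / Fintype.card ε)))
      (expectation src tgt u t (discordantDensity src tgt)) := by
  let B : ((V → Bool) → ℝ) →ₗ[ℝ] ℝ := ∑ η, bernoulliWeight u η • LinearMap.proj η
  have hBapp : ∀ f, B f = ∑ η, bernoulliWeight u η * f η := fun f => by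
    simp [B]
  let Λ : (((V → Bool) → ℝ) →L[ℝ] ((V → Bool) → ℝ)) →L[ℝ] ℝ :=
    (LinearMap.toContinuousLinearMap B).comp
      (ContinuousLinearMap.apply ℝ ((V → Bool) → ℝ) (discordantDensity src tgt))
  have hΛ : ∀ A, Λ A = B (A (discordantDensity src tgt)) := fun A => rfl
  have h := (hasSum_semigroup src tgt t).mapL Λ
  have he : Λ (semigroup src tgt t) = expectation src tgt u t (discordantDensity src tgt) := by
    rw [hΛ, hBapp, expectation]
  rw [he] at h
  refine h.congr_fun fun k => ?_
  have hB : ∀ x y, x ≠ y → B (disagree x y) = 2 * u * (1 - u) := fun x y hxy => by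
    rw [hBapp, sum_bernoulliWeight_mul_disagree u hxy]
  have hc : (Fintype.card ε : ℝ) ≠ 0 := by
    exact_mod_cast Fintype.card_ne_zero
  rw [map_smul, hΛ, discordantDensity_eq, map_smul, map_sum, map_smul, map_sum, smul_eq_mul,
    smul_eq_mul]
  simp only [functional_jumpOp_pow hdeg B _ hB]
  rw [← Finset.mul_sum, Finset.sum_sub_distrib, Finset.sum_const, nsmul_eq_mul, Finset.card_univ]
  field_simp

end Semigroup

end VoterModel

/-! ### Revealing a uniform matching step by step -/

section Revealing

variable {O I : Type*} [Fintype O] [DecidableEq O] [Fintype I] [DecidableEq I]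

/-- The matchings that agree with `ω₀` on `D`. -/
def agreeing (D : Finset O) (ω₀ : O ≃ I) : Finset (O ≃ I) :=
  Finset.univ.filter fun ω => ∀ e ∈ D, ω e = ω₀ e

/-- The conditional expectation of `F` under the uniform law on matchings, given the values on `D`,
as a function of the matching: the average of `F` over the matchings that agree with `ω₀` on `D`. -/
noncomputable def condAvg (D : Finset O) (F : (O ≃ I) → ℝ) (ω₀ : O ≃ I) : ℝ :=
  (∑ ω ∈ agreeing D ω₀, F ω) / ((agreeing D ω₀).card : ℝ)

theorem mem_agreeing {D : Finset O} {ω₀ ω : O ≃ I} :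
    ω ∈ agreeing D ω₀ ↔ ∀ e ∈ D, ω e = ω₀ e := by
  simp [agreeing]

theorem self_mem_agreeing (D : Finset O) (ω₀ : O ≃ I) : ω₀ ∈ agreeing D ω₀ := by
  simp [agreeing]

theorem agreeing_card_pos (D : Finset O) (ω₀ : O ≃ I) : (0 : ℝ) < (agreeing D ω₀).card := by
  exact_mod_cast Finset.card_pos.2 ⟨_, self_mem_agreeing D ω₀⟩

theorem agreeing_congr {D : Finset O} {ω₀ ω : O ≃ I} (h : ω ∈ agreeing D ω₀) :
    agreeing D ω = agreeing D ω₀ := by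
  rw [mem_agreeing] at h
  ext ω'
  simp only [mem_agreeing]
  exact forall₂_congr fun e he => by rw [h e he]

theorem condAvg_congr {D : Finset O} {F G : (O ≃ I) → ℝ} {ω₀ : O ≃ I}
    (h : ∀ ω ∈ agreeing D ω₀, F ω = G ω) : condAvg D F ω₀ = condAvg D G ω₀ := by
  rw [condAvg, condAvg, Finset.sum_congr rfl h]

theorem condAvg_mono {D : Finset O} {F G : (O ≃ I) → ℝ} {ω₀ : O ≃ I}
    (h : ∀ ω ∈ agreeing D ω₀, F ω ≤ G ω) : condAvg D F ω₀ ≤ condAvg D G ω₀ :=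
  div_le_div_of_nonneg_right (Finset.sum_le_sum h) (agreeing_card_pos D ω₀).le

theorem condAvg_const (D : Finset O) (c : ℝ) (ω₀ : O ≃ I) : condAvg D (fun _ => c) ω₀ = c := by
  rw [condAvg, Finset.sum_const, nsmul_eq_mul]
  field_simp [(agreeing_card_pos D ω₀).ne']

theorem condAvg_add (D : Finset O) (F G : (O ≃ I) → ℝ) (ω₀ : O ≃ I) :
    condAvg D (fun ω => F ω + G ω) ω₀ = condAvg D F ω₀ + condAvg D G ω₀ := by
  simp only [condAvg, Finset.sum_add_distrib, add_div]

theorem condAvg_sub (D : Finset O) (F G : (O ≃ I) → ℝ) (ω₀ : O ≃ I) :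
    condAvg D (fun ω => F ω - G ω) ω₀ = condAvg D F ω₀ - condAvg D G ω₀ := by
  simp only [condAvg, Finset.sum_sub_distrib, sub_div]

theorem condAvg_const_mul (D : Finset O) (c : ℝ) (F : (O ≃ I) → ℝ) (ω₀ : O ≃ I) :
    condAvg D (fun ω => c * F ω) ω₀ = c * condAvg D F ω₀ := by
  simp only [condAvg, ← Finset.mul_sum, mul_div_assoc]

theorem condAvg_sum {ι : Type*} (D : Finset O) (s : Finset ι) (F : ι → (O ≃ I) → ℝ)
    (ω₀ : O ≃ I) :
    condAvg D (fun ω => ∑ i ∈ s, F i ω) ω₀ = ∑ i ∈ s, condAvg D (F i) ω₀ := by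
  simp only [condAvg]
  rw [Finset.sum_comm, Finset.sum_div]

theorem abs_condAvg_sub_le {D : Finset O} {F G B : (O ≃ I) → ℝ} {ω₀ : O ≃ I}
    (h : ∀ ω ∈ agreeing D ω₀, |F ω - G ω| ≤ B ω) :
    |condAvg D F ω₀ - condAvg D G ω₀| ≤ condAvg D B ω₀ := by
  have h1 : condAvg D (fun ω => F ω - G ω) ω₀ ≤ condAvg D B ω₀ :=
    condAvg_mono fun ω hω => (abs_le.1 (h ω hω)).2
  have h2 : condAvg D (fun ω => G ω - F ω) ω₀ ≤ condAvg D B ω₀ :=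
    condAvg_mono fun ω hω => by linarith [(abs_le.1 (h ω hω)).1]
  rw [condAvg_sub] at h1 h2
  rw [abs_le]
  constructor <;> linarith

/-- The tower property. -/
theorem condAvg_condAvg {D D' : Finset O} (h : D ⊆ D') (F : (O ≃ I) → ℝ) (ω₀ : O ≃ I) :
    condAvg D (condAvg D' F) ω₀ = condAvg D F ω₀ := by
  have hsub : ∀ ω ∈ agreeing D ω₀, agreeing D' ω ⊆ agreeing D ω₀ := by
    intro ω hω ω' hω'
    rw [mem_agreeing] at *
    exact fun e he => (hω' e (h he)).trans (hω e he)
  have hsymm : ∀ ω ω' : O ≃ I, ω' ∈ agreeing D' ω ↔ ω ∈ agreeing D' ω' := by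
    intro ω ω'
    simp only [mem_agreeing, eq_comm]
  rw [condAvg, condAvg]
  congr 1
  have h1 : ∀ ω ∈ agreeing D ω₀, condAvg D' F ω =
      ∑ ω' ∈ agreeing D ω₀, if ω' ∈ agreeing D' ω then F ω' / (agreeing D' ω').card else 0 := by
    intro ω hω
    rw [← Finset.sum_filter, Finset.filter_mem_eq_inter,
      Finset.inter_eq_right.2 (hsub ω hω), condAvg, Finset.sum_div]
    exact Finset.sum_congr rfl fun ω' hω' => by rw [agreeing_congr hω']
  rw [Finset.sum_congr rfl h1, Finset.sum_comm]
  refine Finset.sum_congr rfl fun ω' hω' => ?_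
  simp only [hsymm _ ω']
  rw [← Finset.sum_filter, Finset.filter_mem_eq_inter,
      Finset.inter_eq_right.2 (hsub ω' hω'), Finset.sum_const, nsmul_eq_mul]
  field_simp [(agreeing_card_pos D' ω').ne']

theorem card_agreeing_filter_eq {D : Finset O} (e : O) (ω₀ : O ≃ I) {i j : I}
    (hi : i ∉ D.image ω₀) (hj : j ∉ D.image ω₀) :
    ((agreeing D ω₀).filter fun ω => ω e = i).card =
      ((agreeing D ω₀).filter fun ω => ω e = j).card := by
  have hstep : ∀ i j : I, i ∉ D.image ω₀ → j ∉ D.image ω₀ → ∀ ω : O ≃ I,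
      ω ∈ (agreeing D ω₀).filter (fun ω => ω e = i) →
        ω.trans (Equiv.swap i j) ∈ (agreeing D ω₀).filter fun ω => ω e = j := by
    intro i j hi hj ω hω
    rw [Finset.mem_filter, mem_agreeing] at *
    refine ⟨fun f hf => ?_, by simp [hω.2]⟩
    rw [Equiv.trans_apply, hω.1 f hf, Equiv.swap_apply_of_ne_of_ne]
    · exact fun h => hi (h ▸ Finset.mem_image_of_mem _ hf)
    · exact fun h => hj (h ▸ Finset.mem_image_of_mem _ hf)
  refine Finset.card_bij' (fun ω _ => ω.trans (Equiv.swap i j))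
    (fun ω _ => ω.trans (Equiv.swap i j)) (hstep i j hi hj) ?_ ?_ ?_
  · intro ω hω
    rw [Equiv.swap_comm]
    exact hstep j i hj hi ω hω
  · intro ω _; ext; simp
  · intro ω _; ext; simp

/-- Given the matching on `D`, an out-stub outside `D` is matched with a uniform in-stub among
those not yet matched. -/
theorem condAvg_apply {D : Finset O} {e : O} (he : e ∉ D) (h : I → ℝ) (ω₀ : O ≃ I) :
    condAvg D (fun ω => h (ω e)) ω₀ =
      (∑ i ∈ (D.image ω₀)ᶜ, h i) / ((Fintype.card O : ℝ) - D.card) := by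
  set A := agreeing D ω₀
  set R := D.image ω₀
  have hmaps : ∀ ω ∈ A, ω e ∈ Rᶜ := by
    intro ω hω
    rw [Finset.mem_compl, Finset.mem_image]
    rintro ⟨f, hf, hfe⟩
    rw [← mem_agreeing.1 hω f hf] at hfe
    exact he (ω.injective hfe ▸ hf)
  have hi0 : ω₀ e ∈ Rᶜ := hmaps ω₀ (self_mem_agreeing D ω₀)
  set N := (A.filter fun ω => ω e = ω₀ e).card with hN
  have hNi : ∀ i ∈ Rᶜ, (A.filter fun ω => ω e = i).card = N := fun i hi =>
    card_agreeing_filter_eq e ω₀ (Finset.mem_compl.1 hi) (Finset.mem_compl.1 hi0)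
  have hNpos : (0 : ℝ) < N := by
    exact_mod_cast Finset.card_pos.2 ⟨ω₀, by simp [A, self_mem_agreeing]⟩
  have hsum : ∀ h : I → ℝ, ∑ ω ∈ A, h (ω e) = N * ∑ i ∈ Rᶜ, h i := by
    intro h
    rw [← Finset.sum_fiberwise_of_maps_to hmaps, Finset.mul_sum]
    refine Finset.sum_congr rfl fun i hi => ?_
    rw [← hNi i hi, ← nsmul_eq_mul, ← Finset.sum_const]
    exact Finset.sum_congr rfl fun ω hω => by rw [(Finset.mem_filter.1 hω).2]
  have hcard : (A.card : ℝ) = N * ((Fintype.card O : ℝ) - D.card) := by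
    have h1 := hsum fun _ => 1
    rw [Finset.sum_const, Finset.sum_const, nsmul_eq_mul, nsmul_eq_mul, mul_one, mul_one] at h1
    rw [h1, Finset.card_compl, Finset.card_image_of_injective _ ω₀.injective,
      ← Fintype.card_congr ω₀, Nat.cast_sub (Finset.card_le_univ D)]
  rw [condAvg, hsum, hcard, mul_div_mul_left _ _ hNpos.ne']

/-- Given the matching on `D`, an unmatched out-stub goes to `S` with probability at most
`|S| / (m - |D|)`. -/
theorem condAvg_mem_le {D : Finset O} {e : O} (he : e ∉ D) (S : Finset I) (ω₀ : O ≃ I) :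
    condAvg D (fun ω => if ω e ∈ S then 1 else 0) ω₀ ≤
      (S.card : ℝ) / ((Fintype.card O : ℝ) - D.card) := by
  rw [condAvg_apply he (fun i => if i ∈ S then 1 else 0)]
  have h0 : (0 : ℝ) ≤ (Fintype.card O : ℝ) - D.card := by
    rw [sub_nonneg]; exact_mod_cast Finset.card_le_univ D
  refine div_le_div_of_nonneg_right ?_ h0
  rw [Finset.sum_boole]
  exact_mod_cast Finset.card_le_card fun i hi => (Finset.mem_filter.1 hi).2

/-- Sampling without replacement from `[0, 1]`-valued data: removing `|D|` in-stubs changes the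
average by at most `|D| / m`. -/
theorem abs_condAvg_apply_sub_average_le {D : Finset O} {e : O} (he : e ∉ D) {h : I → ℝ}
    (h0 : ∀ i, 0 ≤ h i) (h1 : ∀ i, h i ≤ 1) (ω₀ : O ≃ I) :
    |condAvg D (fun ω => h (ω e)) ω₀ - (∑ i, h i) / (Fintype.card O : ℝ)| ≤
      (D.card : ℝ) / Fintype.card O := by
  rw [condAvg_apply he]
  set R := D.image ω₀
  have hR : R.card = D.card := Finset.card_image_of_injective _ ω₀.injective
  have hlt : (D.card : ℝ) < Fintype.card O := by
    exact_mod_cast Finset.card_lt_univ_of_notMem he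
  have hm : (0 : ℝ) < Fintype.card O := lt_of_le_of_lt (Nat.cast_nonneg _) hlt
  set m : ℝ := (Fintype.card O : ℝ)
  set j : ℝ := (D.card : ℝ)
  have hj0 : 0 ≤ j := Nat.cast_nonneg _
  rw [← Finset.sum_compl_add_sum R]
  set a := ∑ i ∈ Rᶜ, h i
  set b := ∑ i ∈ R, h i
  have ha0 : 0 ≤ a := Finset.sum_nonneg fun i _ => h0 i
  have hb0 : 0 ≤ b := Finset.sum_nonneg fun i _ => h0 i
  have ha1 : a ≤ m - j := by
    refine (Finset.sum_le_sum fun i _ => h1 i).trans_eq ?_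
    rw [Finset.sum_const, nsmul_eq_mul, mul_one, Finset.card_compl, hR, ← Fintype.card_congr ω₀,
      Nat.cast_sub (Finset.card_le_univ D)]
  have hb1 : b ≤ j := by
    refine (Finset.sum_le_sum fun i _ => h1 i).trans_eq ?_
    rw [Finset.sum_const, nsmul_eq_mul, mul_one, hR]
  have hmj : 0 < m - j := sub_pos.2 hlt
  have e1 : a / (m - j) - (a + b) / m = (a / (m - j) * j - b) / m := by
    field_simp
    ring
  have e2 : a / (m - j) ≤ 1 := (div_le_one hmj).2 ha1
  have e3 : 0 ≤ a / (m - j) := by positivity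
  rw [e1, abs_div, abs_of_pos hm]
  refine div_le_div_of_nonneg_right ?_ hm.le
  rw [abs_le]
  constructor <;> nlinarith

end Revealing

/-! ### The walks on the graph of a partially revealed matching -/

section Exploration

open VoterModel

/-- The probability that a walk on `ℕ` started at `r` has reached `0` within `k` steps, when each
step goes down with probability `1 / 2`, goes up with probability `ρ / 2`, and otherwise kills the
walk. -/
noncomputable def hitProb (ρ : ℝ) : ℕ → ℕ → ℝ
  | 0, 0 => 1
  | 0, _ + 1 => 0
  | _ + 1, 0 => 1
  | k + 1, r + 1 => 2⁻¹ * hitProb ρ k r + ρ / 2 * hitProb ρ k (r + 2)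

theorem hitProb_zero_right (ρ : ℝ) (k : ℕ) : hitProb ρ k 0 = 1 := by
  cases k <;> simp [hitProb]

theorem hitProb_mem_Icc {ρ : ℝ} (h0 : 0 ≤ ρ) (h1 : ρ ≤ 1) (k r : ℕ) :
    0 ≤ hitProb ρ k r ∧ hitProb ρ k r ≤ 1 := by
  induction k generalizing r with
  | zero => cases r <;> simp [hitProb]
  | succ k ih =>
    cases r with
    | zero => simp [hitProb]
    | succ r =>
      rw [hitProb]
      obtain ⟨a0, a1⟩ := ih r
      obtain ⟨b0, b1⟩ := ih (r + 2)
      constructor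
      · positivity
      · nlinarith

variable {V O I : Type*} [DecidableEq V] [Fintype O] {src : O → V} {vert : I → V}

theorem abs_outAverage_le {x : V} {f : O → ℝ} {b : ℝ} (hb : 0 ≤ b)
    (h : ∀ e, src e = x → |f e| ≤ b) : |outAverage src x f| ≤ b := by
  by_cases hx : outDegree src x = 0
  · simpa [outAverage, hx] using hb
  · rw [abs_le]
    constructor
    · exact (outAverage_const hx (-b)).symm.trans_le
        (outAverage_mono x fun e he => (abs_le.1 (h e he)).1)
    · exact (outAverage_mono x fun e he => (abs_le.1 (h e he)).2).trans_eq
        (outAverage_const hx b)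

theorem outAverage_nonneg (x : V) {f : O → ℝ} (h : ∀ e, 0 ≤ f e) : 0 ≤ outAverage src x f :=
  Finset.sum_nonneg fun e _ => mul_nonneg (by positivity) (h e)

variable [DecidableEq O]

/-- If all but one of the out-edges of `x` contribute little, then only that edge matters. -/
theorem abs_outAverage_sub_le {x : V} {f : O → ℝ} {b y : ℝ} (hb : 0 ≤ b) {h : O} (hx : src h = x)
    (hh : |f h - y| ≤ b) (hf : ∀ e, src e = x → e ≠ h → |f e| ≤ b) :
    |outAverage src x f - 1 / (outDegree src x : ℝ) * y| ≤ b := by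
  have h1 : outAverage src x (fun e => if e = h then y else 0) =
      1 / (outDegree src x : ℝ) * y := by
    rw [outAverage, Finset.sum_eq_single h]
    · simp
    · intro e _ he; simp [he]
    · intro hn; simp [hx] at hn
  rw [← h1, ← outAverage_sub]
  refine abs_outAverage_le hb fun e he => ?_
  by_cases heh : e = h
  · subst heh; simpa using hh
  · simpa [heh] using hf e he heh

variable [Fintype I] [DecidableEq I]

theorem condAvg_outAverage (D : Finset O) (x : V) (H : O → (O ≃ I) → ℝ) (ω₀ : O ≃ I) :
    condAvg D (fun ω => outAverage src x fun e' => H e' ω) ω₀ =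
      outAverage src x fun e' => condAvg D (H e') ω₀ := by
  simp only [outAverage, condAvg_sum, condAvg_const_mul]

/-- Averaging over the out-edges of the vertex that `e` enters amounts to revealing the match of
`e` first. -/
theorem condAvg_outAverage_reveal (D : Finset O) (e : O) (H : O → (O ≃ I) → ℝ) (ω₀ : O ≃ I) :
    condAvg D (fun ω => outAverage src (vert (ω e)) fun e' => H e' ω) ω₀ =
      condAvg D (fun ω => outAverage src (vert (ω e)) fun e' =>
        condAvg (insert e D) (H e') ω) ω₀ := by
  rw [← condAvg_condAvg (Finset.subset_insert e D)]
  refine condAvg_congr fun ω _ => ?_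
  rw [← condAvg_outAverage]
  refine condAvg_congr fun ω' hω' => ?_
  rw [mem_agreeing.1 hω' e (Finset.mem_insert_self e D)]

variable {K : ℕ}

theorem condAvg_vert_mem_image_le (hK : ∀ x, (Finset.univ.filter fun i => vert i = x).card ≤ K)
    {D : Finset O} {e : O} (he : e ∉ D) (T : Finset O) (ω₀ : O ≃ I) :
    condAvg D (fun ω => if vert (ω e) ∈ T.image src then 1 else 0) ω₀ ≤
      (K * T.card : ℝ) / ((Fintype.card O : ℝ) - D.card) := by
  have h := condAvg_mem_le he (Finset.univ.filter fun i => vert i ∈ T.image src) ω₀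
  simp only [Finset.mem_filter, Finset.mem_univ, true_and] at h
  refine h.trans ?_
  have h0 : (0 : ℝ) ≤ (Fintype.card O : ℝ) - D.card := by
    rw [sub_nonneg]; exact_mod_cast Finset.card_le_univ D
  refine div_le_div_of_nonneg_right ?_ h0
  have h1 : (Finset.univ.filter fun i => vert i ∈ T.image src).card ≤
      (T.image src).card * K := by
    rw [Finset.card_eq_sum_card_fiberwise (f := vert) (t := T.image src)
      (s := Finset.univ.filter fun i => vert i ∈ T.image src)
      (fun i hi => by simpa using hi), ← smul_eq_mul, ← Finset.sum_const]
    refine Finset.sum_le_sum fun x _ => le_trans (Finset.card_le_card fun i hi => ?_) (hK x)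
    simpa using (Finset.mem_filter.1 hi).2
  have h2 : (T.image src).card * K ≤ K * T.card := by
    rw [mul_comm]; exact Nat.mul_le_mul_left _ Finset.card_image_le
  exact_mod_cast h1.trans h2

theorem condAvg_vert_eq_le (hK : ∀ x, (Finset.univ.filter fun i => vert i = x).card ≤ K)
    {D : Finset O} {e : O} (he : e ∉ D) (x : V) (ω₀ : O ≃ I) :
    condAvg D (fun ω => if x = vert (ω e) then 1 else 0) ω₀ ≤
      (K : ℝ) / ((Fintype.card O : ℝ) - D.card) := by
  have h := condAvg_mem_le he (Finset.univ.filter fun i => vert i = x) ω₀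
  simp only [Finset.mem_filter, Finset.mem_univ, true_and] at h
  simp only [eq_comm (a := x)]
  have h0 : (0 : ℝ) ≤ (Fintype.card O : ℝ) - D.card := by
    rw [sub_nonneg]; exact_mod_cast Finset.card_le_univ D
  exact h.trans (div_le_div_of_nonneg_right (by exact_mod_cast hK x) h0)

theorem condAvg_vert_eq_vert_le
    (hK : ∀ x, (Finset.univ.filter fun i => vert i = x).card ≤ K)
    {D : Finset O} {e f : O} (hef : e ≠ f) (hf : f ∉ D) {b : ℝ} (hb : 0 < b)
    (hbD : b ≤ (Fintype.card O : ℝ) - (insert e D).card) (ω₀ : O ≃ I) :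
    condAvg D (fun ω => if vert (ω e) = vert (ω f) then 1 else 0) ω₀ ≤ (K : ℝ) / b := by
  rw [← condAvg_condAvg (Finset.subset_insert e D)]
  have hfe : f ∉ insert e D := by simp [hef.symm, hf]
  refine (condAvg_mono fun ω _ => ?_).trans_eq (condAvg_const D _ ω₀)
  have h : condAvg (insert e D) (fun ω => if vert (ω e) = vert (ω f) then (1 : ℝ) else 0) ω =
      condAvg (insert e D) (fun ω' => if vert (ω e) = vert (ω' f) then 1 else 0) ω :=
    condAvg_congr fun ω' hω' => by
      rw [mem_agreeing.1 hω' e (Finset.mem_insert_self e D)]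
  rw [h]
  exact (condAvg_vert_eq_le hK hfe _ ω).trans (div_le_div_of_nonneg_left (by positivity) hb hbD)

omit [DecidableEq O] in
/-- One step of the pair of walks, disregarding the absorption on the diagonal. -/
theorem abs_meetProb_succ_sub_le (src tgt : O → V) (k : ℕ) (x y : V) :
    |meetProb src tgt (k + 1) x y -
      (2⁻¹ * outAverage src x (fun e => meetProb src tgt k (tgt e) y) +
        2⁻¹ * outAverage src y (fun e => meetProb src tgt k x (tgt e)))| ≤
      if x = y then 1 else 0 := by
  rw [meetProb]
  split_ifs with h
  · have h1 := outAverage_le_one (src := src) x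
      (fun e => meetProb_le_one (src := src) (tgt := tgt) k (tgt e) y)
    have h2 := outAverage_le_one (src := src) y
      (fun e => meetProb_le_one (src := src) (tgt := tgt) k x (tgt e))
    have h3 := outAverage_nonneg (src := src) x
      (fun e => meetProb_nonneg (src := src) (tgt := tgt) k (tgt e) y)
    have h4 := outAverage_nonneg (src := src) y
      (fun e => meetProb_nonneg (src := src) (tgt := tgt) k x (tgt e))
    rw [abs_le]
    constructor <;> linarith
  · simp

/-- Two walks about to use distinct unrevealed out-stubs are unlikely to meet: at each step, the
newly revealed vertex is with high probability one of which nothing has been revealed. The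
in-degrees are at most `K`, and `N` bounds the number of out-stubs that are used before the `k` jumps are
over. -/
theorem condAvg_meetProb_le_of_ne
    (hK : ∀ x, (Finset.univ.filter fun i => vert i = x).card ≤ K) {N : ℕ}
    (hN : 2 * N ≤ Fintype.card O) (k : ℕ) {D : Finset O} {e f : O} (hef : e ≠ f) (he : e ∉ D)
    (hf : f ∉ D) (hD : D.card + k + 2 ≤ N) (ω₀ : O ≃ I) :
    condAvg D (fun ω => meetProb src (fun e => vert (ω e)) k (vert (ω e)) (vert (ω f))) ω₀ ≤
      (k + 1) * (4 * K * N / Fintype.card O) := by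
  have hNm : 2 * (N : ℝ) ≤ (Fintype.card O : ℝ) := by exact_mod_cast hN
  set m : ℝ := (Fintype.card O : ℝ) with hm
  have hN1 : (1 : ℝ) ≤ N := by exact_mod_cast (by omega : 1 ≤ N)
  have hm0 : 0 < m := by linarith
  have hK0 : (0 : ℝ) ≤ K := Nat.cast_nonneg K
  have hc0 : 0 ≤ 4 * K * N / m := by positivity
  have hcollide : ∀ {D : Finset O} {e f : O} (ω₀ : O ≃ I), e ≠ f → f ∉ D → D.card + 2 ≤ N →
      condAvg D (fun ω => if vert (ω e) = vert (ω f) then 1 else 0) ω₀ ≤ 2 * K * N / m := by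
    intro D e f ω₀ hef hf hD
    have h1 : (((insert e D).card : ℕ) : ℝ) ≤ N := by
      exact_mod_cast (Finset.card_insert_le e D).trans (by omega)
    refine (condAvg_vert_eq_vert_le hK hef hf (half_pos hm0) (by linarith) ω₀).trans ?_
    rw [div_le_div_iff₀ (half_pos hm0) hm0]
    nlinarith [mul_nonneg hK0 hm0.le]
  induction k generalizing D e f ω₀ with
  | zero =>
    simp only [meetProb]
    refine (hcollide ω₀ hef hf (by omega)).trans ?_
    rw [Nat.cast_zero, zero_add, one_mul]
    gcongr
    norm_num
  | succ k ih =>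
    have hhalf : ∀ {e f : O}, e ≠ f → e ∉ D → f ∉ D →
        condAvg D (fun ω => outAverage src (vert (ω e)) fun e' =>
          meetProb src (fun e => vert (ω e)) k (vert (ω e')) (vert (ω f))) ω₀ ≤
        2 * K * N / m + (k + 1) * (4 * K * N / m) := by
      intro e f hef he hf
      rw [condAvg_outAverage_reveal D e
        (fun e' ω => meetProb src (fun e => vert (ω e)) k (vert (ω e')) (vert (ω f)))]
      have hbad : condAvg D (fun ω =>
          if vert (ω e) ∈ (insert f (insert e D)).image src then 1 else 0) ω₀ ≤
            2 * K * N / m := by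
        refine (condAvg_vert_mem_image_le hK he _ ω₀).trans ?_
        have h1 : ((D.card : ℕ) : ℝ) ≤ N := by exact_mod_cast (by omega : D.card ≤ N)
        have h2 : (((insert f (insert e D)).card : ℕ) : ℝ) ≤ N := by
          have := Finset.card_insert_le f (insert e D)
          have := Finset.card_insert_le e D
          exact_mod_cast (by omega : (insert f (insert e D)).card ≤ N)
        rw [← hm, div_le_div_iff₀ (by linarith) hm0]
        have h3 : K * ((insert f (insert e D)).card : ℝ) ≤ K * N :=
          mul_le_mul_of_nonneg_left h2 hK0
        have h4 : (0 : ℝ) ≤ K * N := by positivity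
        nlinarith
      refine le_trans ?_ (add_le_add_left hbad _)
      rw [← condAvg_const D ((k + 1) * (4 * K * N / m)) ω₀, ← condAvg_add]
      refine condAvg_mono fun ω _ => ?_
      have hc1 : 0 ≤ ((k : ℝ) + 1) * (4 * K * N / m) := by positivity
      by_cases hfresh : vert (ω e) ∈ (insert f (insert e D)).image src
      · rw [if_pos hfresh]
        have := outAverage_le_one (src := src) (vert (ω e)) (f := fun e' => condAvg (insert e D)
          (fun ω => meetProb src (fun e => vert (ω e)) k (vert (ω e')) (vert (ω f))) ω)
          (fun e' => (condAvg_mono fun ω' _ => meetProb_le_one _ _ _).trans_eq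
            (condAvg_const _ 1 ω))
        linarith
      · rw [if_neg hfresh, zero_add]
        refine le_of_abs_le (abs_outAverage_le hc1 fun e' he' => ?_)
        have hnot : ∀ s ∈ insert f (insert e D), e' ≠ s := fun s hs h =>
          hfresh (Finset.mem_image.2 ⟨s, hs, h ▸ he'⟩)
        rw [abs_of_nonneg ((condAvg_const (insert e D) 0 ω).symm.trans_le
          (condAvg_mono fun ω' _ => meetProb_nonneg _ _ _))]
        refine ih (hnot f (Finset.mem_insert_self _ _))
          (fun h => hnot e' (Finset.mem_insert_of_mem h) rfl) (by simp [hef.symm, hf]) ?_ ω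
        rw [Finset.card_insert_of_notMem he]
        omega
    have h1 := hhalf hef he hf
    have h2 := hhalf hef.symm hf he
    have h3 := hcollide ω₀ hef hf (by omega)
    have h4 : condAvg D (fun ω =>
        meetProb src (fun e => vert (ω e)) (k + 1) (vert (ω e)) (vert (ω f))) ω₀ ≤
        condAvg D (fun ω => (if vert (ω e) = vert (ω f) then 1 else 0) +
          (2⁻¹ * (outAverage src (vert (ω e)) fun e' =>
            meetProb src (fun e => vert (ω e)) k (vert (ω e')) (vert (ω f))) +
          2⁻¹ * (outAverage src (vert (ω f)) fun e' =>
            meetProb src (fun e => vert (ω e)) k (vert (ω e')) (vert (ω e))))) ω₀ := by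
      refine condAvg_mono fun ω _ => ?_
      have := (abs_le.1 (abs_meetProb_succ_sub_le src (fun e => vert (ω e)) k
        (vert (ω e)) (vert (ω f)))).2
      simp only [meetProb_symm k (vert (ω e))] at this
      simp only [meetProb_symm k _ (vert (ω f))] at this ⊢
      linarith
    rw [condAvg_add, condAvg_add, condAvg_const_mul, condAvg_const_mul] at h4
    have h5 : 4 * K * N / m = 2 * (2 * K * N / m) := by ring
    push_cast
    rw [h5] at h1 h2 ⊢
    linarith

/-- A walk sits at the source of the first out-stub of the list `l ++ [f]` and the other one has
gone through all of these out-stubs, the match of the last one not being revealed yet: `Trail D ω l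
f` says that, of the out-stubs at the vertices of the trail, exactly those of `l` have a revealed
match, that these matches link the trail, and that the out-stub `f` issues from a vertex different
from the earlier ones. -/
def Trail (src : O → V) (vert : I → V) (D : Finset O) (ω : O ≃ I) : List O → O → Prop
  | [], f => ∀ e, src e = src f → e ∉ D
  | e :: l, f => e ∈ D ∧ vert (ω e) = src (l.headD f) ∧ (∀ e', src e' = src e → e' ≠ e → e' ∉ D) ∧
      src e ≠ src f ∧ Trail src vert D ω l f

/-- The probability of following the trail `l ++ [f]`. -/
noncomputable def trailWeight (src : O → V) : List O → O → ℝ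
  | [], f => 1 / (outDegree src (src f) : ℝ)
  | e :: l, f => 1 / (outDegree src (src e) : ℝ) * trailWeight src l f

omit [DecidableEq O] in
theorem trailWeight_mem_Icc (l : List O) (f : O) :
    0 ≤ trailWeight src l f ∧ trailWeight src l f ≤ 1 := by
  have h : ∀ x, 0 ≤ 1 / (outDegree src x : ℝ) ∧ 1 / (outDegree src x : ℝ) ≤ 1 := fun x => by
    rw [one_div]
    exact ⟨by positivity, Nat.cast_inv_le_one _⟩
  induction l with
  | nil => exact h _
  | cons e l ih => exact ⟨mul_nonneg (h _).1 ih.1, mul_le_one₀ (h _).2 ih.1 ih.2⟩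

omit [DecidableEq O] in
theorem trailWeight_append (l : List O) (f e : O) :
    trailWeight src (l ++ [f]) e = trailWeight src l f * (1 / (outDegree src (src e) : ℝ)) := by
  induction l with
  | nil => rfl
  | cons a l ih => rw [List.cons_append, trailWeight, ih, trailWeight, mul_assoc]

omit [DecidableEq V] [Fintype O] [DecidableEq O] [Fintype I] [DecidableEq I] in
theorem Trail.notMem {D : Finset O} {ω : O ≃ I} {l : List O} {f : O}
    (h : Trail src vert D ω l f) : f ∉ D := by
  induction l with
  | nil => exact h f rfl
  | cons e l ih => exact ih h.2.2.2.2

omit [DecidableEq V] [Fintype O] [Fintype I] [DecidableEq I] in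
/-- Revealing the last match of a trail extends the trail if it leads to a fresh vertex. -/
theorem Trail.append {D : Finset O} {ω₀ ω : O ≃ I} {l : List O} {f e : O}
    (h : Trail src vert D ω₀ l f) (hω : ∀ e ∈ D, ω e = ω₀ e) (he : vert (ω f) = src e)
    (hfresh : ∀ e' ∈ insert f D, src e' ≠ src e) :
    Trail src vert (insert f D) ω (l ++ [f]) e := by
  induction l with
  | nil =>
    refine ⟨Finset.mem_insert_self _ _, he, fun e' h1 h2 h3 => ?_, ?_, fun e' h1 h2 => ?_⟩
    · exact h e' h1 ((Finset.mem_insert.1 h3).resolve_left h2)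
    · exact hfresh f (Finset.mem_insert_self _ _)
    · exact hfresh e' h2 h1
  | cons a l ih =>
    obtain ⟨h1, h2, h3, h4, h5⟩ := h
    refine ⟨Finset.mem_insert_of_mem h1, ?_, fun e' g1 g2 g3 => ?_, ?_, ih h5⟩
    · rw [hω a h1, h2]
      cases l <;> rfl
    · rcases Finset.mem_insert.1 g3 with g | g
      · exact h4 (g ▸ g1).symm
      · exact h3 e' g1 g2 g
    · exact hfresh a (Finset.mem_insert_of_mem h1)

/-- The walk that trails behind meets the other one, up to a small probability, only by following
its trail; the distance between the two walks along the trail then evolves like the walk of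
`hitProb`, each out-stub added to the trail being followed with probability `ρ` on average. -/
theorem abs_condAvg_meetProb_sub_le
    (hK : ∀ x, (Finset.univ.filter fun i => vert i = x).card ≤ K) (hK1 : 1 ≤ K)
    (hdeg : ∀ x, outDegree src x ≠ 0) {ρ : ℝ}
    (hρ : ρ = (∑ i, 1 / (outDegree src (vert i) : ℝ)) / Fintype.card O)
    (hρ0 : 0 ≤ ρ) (hρ1 : ρ ≤ 1) {N : ℕ}
    (hN : 2 * N ≤ Fintype.card O) (k : ℕ) {D : Finset O} {l : List O} {f : O} (ω₀ : O ≃ I)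
    (hl : Trail src vert D ω₀ l f) (hD : D.card + k + 2 ≤ N) :
    |condAvg D (fun ω => meetProb src (fun e => vert (ω e)) k (src (l.headD f)) (vert (ω f))) ω₀ -
      trailWeight src l f * hitProb ρ k (l.length + 1)| ≤
      (k + 1) * (4 * K * N / Fintype.card O) := by
  have hdiv := fun k {D : Finset O} {e f : O} => condAvg_meetProb_le_of_ne
    (src := src) hK hN k (D := D) (e := e) (f := f)
  have hNm : 2 * (N : ℝ) ≤ (Fintype.card O : ℝ) := by exact_mod_cast hN
  have hmean := fun {D : Finset O} {e : O} (he : e ∉ D) =>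
    abs_condAvg_apply_sub_average_le he (h := fun i => 1 / (outDegree src (vert i) : ℝ))
      (fun i => by positivity) (fun i => by rw [one_div]; exact Nat.cast_inv_le_one _)
  rw [← hρ] at hmean
  set m : ℝ := (Fintype.card O : ℝ) with hm
  have hN1 : (1 : ℝ) ≤ N := by exact_mod_cast (by omega : 1 ≤ N)
  have hm0 : 0 < m := by linarith
  have hK0 : (1 : ℝ) ≤ K := by exact_mod_cast hK1
  have hc0 : 0 ≤ 4 * K * N / m := by positivity
  have hcollide : ∀ {D : Finset O} {f : O} (x : V) (ω₀ : O ≃ I), f ∉ D → D.card + 2 ≤ N →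
      condAvg D (fun ω => if x = vert (ω f) then 1 else 0) ω₀ ≤ 2 * K / m := by
    intro D f x ω₀ hf hD
    have h1 : ((D.card : ℕ) : ℝ) ≤ N := by exact_mod_cast (by omega : D.card ≤ N)
    refine (condAvg_vert_eq_le hK hf x ω₀).trans ?_
    rw [← hm, div_le_div_iff₀ (by linarith) hm0]
    nlinarith
  induction k generalizing D l f ω₀ with
  | zero =>
    have h := hcollide (src (l.headD f)) ω₀ hl.notMem (by omega)
    have h0 : 0 ≤ condAvg D (fun ω => if src (l.headD f) = vert (ω f) then 1 else 0) ω₀ :=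
      (condAvg_const D 0 ω₀).symm.trans_le (condAvg_mono fun ω' _ => by positivity)
    simp only [meetProb, hitProb, mul_zero, sub_zero]
    rw [abs_of_nonneg h0]
    refine h.trans ?_
    rw [Nat.cast_zero, zero_add, one_mul]
    gcongr ?_ / _
    nlinarith
  | succ k ih =>
    have hfD := hl.notMem
    have hw := trailWeight_mem_Icc (src := src) l f
    have hc1 : 0 ≤ ((k : ℝ) + 1) * (4 * K * N / m) := by positivity
    have hg := fun r => hitProb_mem_Icc hρ0 hρ1 k r
    set x := src (l.headD f) with hx
    have hA : |condAvg D (fun ω => outAverage src x fun e' =>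
        meetProb src (fun e => vert (ω e)) k (vert (ω e')) (vert (ω f))) ω₀ -
          trailWeight src l f * hitProb ρ k l.length| ≤ (k + 1) * (4 * K * N / m) := by
      rw [condAvg_outAverage D x
        (fun e' ω => meetProb src (fun e => vert (ω e)) k (vert (ω e')) (vert (ω f)))]
      have hother : ∀ e', e' ∉ D → e' ≠ f → |condAvg D (fun ω =>
          meetProb src (fun e => vert (ω e)) k (vert (ω e')) (vert (ω f))) ω₀| ≤
          (k + 1) * (4 * K * N / m) := by
        intro e' h1 h2
        rw [abs_of_nonneg ((condAvg_const D 0 ω₀).symm.trans_le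
          (condAvg_mono fun ω' _ => meetProb_nonneg _ _ _))]
        exact hdiv k h2 h1 hfD (by omega) ω₀
      cases l with
      | nil =>
        refine abs_outAverage_sub_le hc1 (h := f) rfl ?_ fun e' h1 h2 => hother e' (hl e' h1) h2
        simp only [meetProb_self, condAvg_const, List.length_nil, hitProb_zero_right, sub_self,
          abs_zero]
        exact hc1
      | cons a l =>
        obtain ⟨h1, h2, h3, h4, h5⟩ := hl
        rw [trailWeight, mul_assoc]
        refine abs_outAverage_sub_le hc1 (h := a) rfl ?_ fun e' g1 g2 =>
          hother e' (h3 e' g1 g2) fun h => h4 (h ▸ g1).symm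
        have := ih ω₀ h5 (by omega)
        rw [← h2] at this
        rw [List.length_cons]
        convert this using 3
        refine condAvg_congr fun ω hω => ?_
        rw [mem_agreeing.1 hω a h1]
    -- the leading walk moves: it reveals the match of `f` and extends the trail
    have hB : |condAvg D (fun ω => outAverage src (vert (ω f)) fun e' =>
        meetProb src (fun e => vert (ω e)) k x (vert (ω e'))) ω₀ -
          trailWeight src l f * (ρ * hitProb ρ k (l.length + 2))| ≤
        (k + 1) * (4 * K * N / m) + (2 * K * N / m + N / m) := by
      rw [condAvg_outAverage_reveal D f
        (fun e' ω => meetProb src (fun e => vert (ω e)) k x (vert (ω e')))]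
      set w := trailWeight src l f * hitProb ρ k (l.length + 2) with hwdef
      have hw0 : 0 ≤ w := mul_nonneg hw.1 (hg _).1
      have hw1 : w ≤ 1 := mul_le_one₀ hw.2 (hg _).1 (hg _).2
      have hDN : ((D.card : ℕ) : ℝ) ≤ N := by exact_mod_cast (by omega : D.card ≤ N)
      have hbad : condAvg D (fun ω =>
          if vert (ω f) ∈ (insert f D).image src then 1 else 0) ω₀ ≤ 2 * K * N / m := by
        refine (condAvg_vert_mem_image_le hK hfD _ ω₀).trans ?_
        have h2 : (((insert f D).card : ℕ) : ℝ) ≤ N := by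
          have := Finset.card_insert_le f D
          exact_mod_cast (by omega : (insert f D).card ≤ N)
        rw [← hm, div_le_div_iff₀ (by linarith) hm0]
        have h3 : K * ((insert f D).card : ℝ) ≤ K * N :=
          mul_le_mul_of_nonneg_left h2 (by linarith)
        have h4 : (0 : ℝ) ≤ K * N := by positivity
        nlinarith
      have hρw : |condAvg D (fun ω => w * (1 / (outDegree src (vert (ω f)) : ℝ))) ω₀ - w * ρ| ≤
          N / m := by
        rw [condAvg_const_mul, ← mul_sub, abs_mul, abs_of_nonneg hw0]
        refine (mul_le_of_le_one_left (abs_nonneg _) hw1).trans ((hmean hfD ω₀).trans ?_)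
        gcongr
      have hmain : ∀ ω ∈ agreeing D ω₀,
          |(outAverage src (vert (ω f)) fun e' => condAvg (insert f D)
            (fun ω => meetProb src (fun e => vert (ω e)) k x (vert (ω e'))) ω) -
            w * (1 / (outDegree src (vert (ω f)) : ℝ))| ≤
          (if vert (ω f) ∈ (insert f D).image src then 1 else 0) +
            (k + 1) * (4 * K * N / m) := by
        intro ω hω
        have hp : 0 ≤ 1 / (outDegree src (vert (ω f)) : ℝ) ∧
            1 / (outDegree src (vert (ω f)) : ℝ) ≤ 1 := by
          rw [one_div]
          exact ⟨by positivity, Nat.cast_inv_le_one _⟩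
        by_cases hfresh : vert (ω f) ∈ (insert f D).image src
        · rw [if_pos hfresh]
          have h1 := outAverage_le_one (src := src) (vert (ω f)) (f := fun e' =>
            condAvg (insert f D)
            (fun ω => meetProb src (fun e => vert (ω e)) k x (vert (ω e'))) ω)
            (fun e' => (condAvg_mono fun ω' _ => meetProb_le_one _ _ _).trans_eq
              (condAvg_const _ 1 ω))
          have h2 := outAverage_nonneg (src := src) (vert (ω f)) (f := fun e' =>
            condAvg (insert f D)
            (fun ω => meetProb src (fun e => vert (ω e)) k x (vert (ω e'))) ω)
            (fun e' => (condAvg_const _ 0 ω).symm.trans_le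
              (condAvg_mono fun ω' _ => meetProb_nonneg _ _ _))
          have h3 : 0 ≤ w * (1 / (outDegree src (vert (ω f)) : ℝ)) := mul_nonneg hw0 hp.1
          have h4 : w * (1 / (outDegree src (vert (ω f)) : ℝ)) ≤ 1 :=
            mul_le_one₀ hw1 hp.1 hp.2
          rw [abs_le]
          constructor <;> linarith
        · rw [if_neg hfresh, zero_add]
          rw [← outAverage_const (hdeg (vert (ω f))) (w * (1 / (outDegree src (vert (ω f)) : ℝ))),
            ← outAverage_sub]
          refine abs_outAverage_le hc1 fun e' he' => ?_
          have htrail := hl.append (e := e') (mem_agreeing.1 hω) he'.symm fun s hs h =>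
            hfresh (Finset.mem_image.2 ⟨s, hs, h.trans he'⟩)
          have h1 := ih ω htrail (by rw [Finset.card_insert_of_notMem hfD]; omega)
          rw [trailWeight_append, List.length_append, List.length_singleton, he'] at h1
          have h2 : src ((l ++ [f]).headD e') = x := by
            rw [hx]
            cases l <;> rfl
          rw [h2, mul_right_comm] at h1
          exact h1
      have h1 := abs_condAvg_sub_le hmain
      rw [condAvg_add, condAvg_const] at h1
      have h2 : trailWeight src l f * (ρ * hitProb ρ k (l.length + 2)) = w * ρ := by
        rw [hwdef]; ring
      rw [h2]
      refine (abs_sub_le _ _ _).trans ((add_le_add h1 hρw).trans ?_)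
      linarith
    have hC := hcollide x ω₀ hfD (by omega)
    have hstep := abs_condAvg_sub_le (D := D) (ω₀ := ω₀) fun ω _ =>
      abs_meetProb_succ_sub_le src (fun e => vert (ω e)) k x (vert (ω f))
    rw [condAvg_add, condAvg_const_mul, condAvg_const_mul] at hstep
    rw [hitProb]
    have e1 : N / m ≤ K * N / m := div_le_div_of_nonneg_right (by nlinarith) hm0.le
    have e2 : 2 * K / m ≤ 2 * K * N / m := div_le_div_of_nonneg_right (by nlinarith) hm0.le
    have e3 : 4 * K * N / m = 4 * (K * N / m) := by ring
    have e4 : 2 * K * N / m = 2 * (K * N / m) := by ring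
    rw [e4] at hB e2
    rw [e3] at hA hB ⊢
    rw [abs_le] at hA hB hstep ⊢
    push_cast
    constructor <;> linarith

end Exploration

/-! ### Catalan numbers and the hitting probabilities -/

section Catalan

open PowerSeries in
theorem coeff_catalanSeries_pow_succ (r s : ℕ) :
    coeff (s + 1) (catalanSeries ^ (r + 1)) =
      coeff (s + 1) (catalanSeries ^ r) + coeff s (catalanSeries ^ (r + 2)) := by
  have h : catalanSeries ^ (r + 1) = catalanSeries ^ r + catalanSeries ^ (r + 2) * X := by
    calc catalanSeries ^ (r + 1) = catalanSeries ^ r * (catalanSeries ^ 2 * X + 1) := by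
          rw [catalanSeries_sq_mul_X_add_one, pow_succ]
      _ = _ := by ring
  rw [h, map_add, coeff_succ_mul_X]

open PowerSeries in
/-- The hitting probabilities are the partial sums of the powers of the Catalan generating
function. The number `N` of summands is irrelevant as long as it exceeds `k`. -/
theorem hitProb_eq_sum (ρ : ℝ) (k r : ℕ) {N : ℕ} (hN : k < N) :
    hitProb ρ k r = 2⁻¹ ^ r * ∑ s ∈ Finset.range N,
      if r + 2 * s ≤ k then (ρ / 4) ^ s * (coeff s (catalanSeries ^ r) : ℕ) else 0 := by
  have hzero : ∀ k N : ℕ, k < N → (1 : ℝ) = 2⁻¹ ^ 0 * ∑ s ∈ Finset.range N,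
      if 0 + 2 * s ≤ k then (ρ / 4) ^ s * (coeff s (catalanSeries ^ 0) : ℕ) else 0 := by
    intro k N hN
    rw [Finset.sum_eq_single 0]
    · simp
    · intro s _ hs; simp [coeff_one, hs]
    · intro h; simp at h; omega
  induction k generalizing r N with
  | zero =>
    cases r with
    | zero => rw [hitProb]; exact hzero 0 N hN
    | succ r =>
      rw [hitProb, Finset.sum_eq_zero, mul_zero]
      intro s _
      rw [if_neg (by omega)]
  | succ k ih =>
    cases r with
    | zero => rw [hitProb_zero_right]; exact hzero _ N hN
    | succ r =>
      obtain ⟨N, rfl⟩ : ∃ M, N = M + 1 := ⟨N - 1, by omega⟩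
      rw [hitProb, ih r (N := N + 1) (by omega), ih (r + 2) (N := N) (by omega),
        Finset.sum_range_succ' _ N, Finset.sum_range_succ' _ N]
      have h1 : ∀ s, (if r + 1 + 2 * (s + 1) ≤ k + 1 then
          (ρ / 4) ^ (s + 1) * ((coeff (s + 1) (catalanSeries ^ (r + 1)) : ℕ) : ℝ) else 0) =
          (if r + 2 * (s + 1) ≤ k then
            (ρ / 4) ^ (s + 1) * ((coeff (s + 1) (catalanSeries ^ r) : ℕ) : ℝ) else 0) +
          ρ / 4 * (if r + 2 + 2 * s ≤ k then
            (ρ / 4) ^ s * ((coeff s (catalanSeries ^ (r + 2)) : ℕ) : ℝ) else 0) := by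
        intro s
        rw [coeff_catalanSeries_pow_succ]
        by_cases h : r + 2 + 2 * s ≤ k
        · rw [if_pos (by omega), if_pos (by omega), if_pos h]
          push_cast
          ring
        · rw [if_neg (by omega), if_neg (by omega), if_neg h]
          ring
      simp only [h1, Finset.sum_add_distrib, ← Finset.mul_sum]
      have h2 : (if r + 1 + 2 * 0 ≤ k + 1 then
          (ρ / 4) ^ 0 * ((coeff 0 (catalanSeries ^ (r + 1)) : ℕ) : ℝ) else 0) =
          if r + 2 * 0 ≤ k then
            (ρ / 4) ^ 0 * ((coeff 0 (catalanSeries ^ r) : ℕ) : ℝ) else 0 := by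
        simp
      rw [h2]
      ring

/-- The summands of the Catalan generating function at `ρ / 4`. -/
noncomputable def catalanTerm (ρ : ℝ) (s : ℕ) : ℝ :=
  ((2 : ℝ) ^ (2 * s))⁻¹ * (catalan s : ℝ) * ρ ^ s

theorem two_mul_hitProb_one (ρ : ℝ) (k : ℕ) :
    2 * hitProb ρ k 1 = ∑ s ∈ Finset.range ((k + 1) / 2), catalanTerm ρ s := by
  rw [hitProb_eq_sum ρ k 1 (Nat.lt_succ_self k), pow_one, mul_inv_cancel_left₀ two_ne_zero, pow_one,
    ← Finset.sum_filter]
  refine Finset.sum_congr ?_ fun s _ => ?_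
  · ext s
    simp only [Finset.mem_filter, Finset.mem_range]
    omega
  · rw [PowerSeries.catalanSeries_coeff, catalanTerm, div_pow, pow_mul]
    norm_num
    ring

/-- The bracket in the definition of `BiDegreeSequence.phi`. -/
theorem phi_bracket_eq (ρ : ℝ) (k : ℕ) :
    ((if 2 < k then
        ∑ s ∈ Finset.Icc 1 ((k - 1) / 2), ((2 : ℝ) ^ (2 * s))⁻¹ * (catalan s : ℝ) * ρ ^ s
      else 0) + (if 0 < k then 1 else 0)) = 2 * hitProb ρ k 1 := by
  rw [two_mul_hitProb_one]
  rcases Nat.eq_zero_or_pos k with rfl | hk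
  · simp
  · have h1 : (k + 1) / 2 = (k - 1) / 2 + 1 := by omega
    have h2 : (if 2 < k then
        ∑ s ∈ Finset.Icc 1 ((k - 1) / 2), ((2 : ℝ) ^ (2 * s))⁻¹ * (catalan s : ℝ) * ρ ^ s
      else 0) = ∑ s ∈ Finset.Icc 1 ((k - 1) / 2), catalanTerm ρ s := by
      split_ifs with h
      · rfl
      · rw [show (k - 1) / 2 = 0 by omega]; simp
    have h3 : ∀ M, ∑ s ∈ Finset.Icc 1 M, catalanTerm ρ s =
        ∑ s ∈ Finset.range M, catalanTerm ρ (s + 1) := by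
      intro M
      induction M with
      | zero => simp
      | succ M ih => rw [Finset.sum_Icc_succ_top (by omega), ih, Finset.sum_range_succ]
    rw [h2, if_pos hk, h1, Finset.sum_range_succ', h3]
    simp [catalanTerm]

theorem catalan_le_four_pow (s : ℕ) : catalan s ≤ 2 ^ (2 * s) := by
  rw [catalan_eq_centralBinom_div]
  exact (Nat.div_le_self _ _).trans (Nat.choose_le_two_pow _ _)

variable {ρ : ℝ}

theorem catalanTerm_nonneg (h0 : 0 ≤ ρ) (s : ℕ) : 0 ≤ catalanTerm ρ s := by
  unfold catalanTerm; positivity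

theorem catalanTerm_le (h0 : 0 ≤ ρ) (h1 : ρ ≤ 1 / 2) (s : ℕ) :
    catalanTerm ρ s ≤ (1 / 2) ^ s := by
  have hc : (catalan s : ℝ) ≤ 2 ^ (2 * s) := by exact_mod_cast catalan_le_four_pow s
  have : ((2 : ℝ) ^ (2 * s))⁻¹ * (catalan s : ℝ) ≤ 1 := by
    rw [inv_mul_le_iff₀ (by positivity)]; simpa using hc
  refine (mul_le_of_le_one_left (by positivity) this).trans ?_
  gcongr

theorem summable_catalanTerm (h0 : 0 ≤ ρ) (h1 : ρ ≤ 1 / 2) : Summable (catalanTerm ρ) :=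
  Summable.of_nonneg_of_le (catalanTerm_nonneg h0) (catalanTerm_le h0 h1)
    summable_geometric_two

theorem catalanTerm_succ (s : ℕ) : catalanTerm ρ (s + 1) =
    ρ / 4 * ∑ p ∈ Finset.HasAntidiagonal.antidiagonal s, catalanTerm ρ p.1 * catalanTerm ρ p.2 := by
  have h : ∀ p ∈ Finset.HasAntidiagonal.antidiagonal s, catalanTerm ρ p.1 * catalanTerm ρ p.2 =
      ((2 : ℝ) ^ (2 * s))⁻¹ * ρ ^ s * (catalan p.1 * catalan p.2 : ℕ) := by
    intro p hp
    rw [← Finset.HasAntidiagonal.mem_antidiagonal.1 hp, catalanTerm, catalanTerm, mul_add, pow_add,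
      pow_add, mul_inv]
    push_cast
    ring
  rw [Finset.sum_congr rfl h, ← Finset.mul_sum, ← Nat.cast_sum, ← catalan_succ', catalanTerm,
    mul_add, pow_add, mul_inv]
  ring

/-- The Catalan generating function. Of the two roots of the quadratic equation it satisfies, the
bound `∑ ≤ 2` selects the smaller one. -/
theorem tsum_catalanTerm (h0 : 0 < ρ) (h1 : ρ ≤ 1 / 2) :
    ∑' s, catalanTerm ρ s = 2 * ((1 - √(1 - ρ)) / ρ) := by
  have hs := summable_catalanTerm h0.le h1
  set S := ∑' s, catalanTerm ρ s with hS
  have hS2 : S ≤ 2 := by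
    rw [← tsum_geometric_two]
    exact hs.tsum_le_tsum (catalanTerm_le h0.le h1) summable_geometric_two
  have hquad : S = 1 + ρ / 4 * (S * S) := by
    have h2 := hs.norm
    rw [hS, tsum_mul_tsum_eq_tsum_sum_antidiagonal_of_summable_norm h2 h2, ← tsum_mul_left]
    nth_rewrite 1 [hs.tsum_eq_zero_add]
    simp only [catalanTerm_succ]
    simp [catalanTerm]
  have hroot : √(1 - ρ) = 1 - ρ * S / 2 := by
    rw [Real.sqrt_eq_iff_mul_self_eq (by linarith) (by nlinarith)]
    linear_combination ρ * hquad
  rw [hroot]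
  field_simp
  ring

/-- The hitting probabilities converge geometrically, uniformly in `ρ ≤ 1 / 2`. -/
theorem abs_two_mul_hitProb_one_sub_le (h0 : 0 < ρ) (h1 : ρ ≤ 1 / 2) (k : ℕ) :
    |2 * hitProb ρ k 1 - 2 * ((1 - √(1 - ρ)) / ρ)| ≤ 2 * (3 / 4) ^ k := by
  have hs := summable_catalanTerm h0.le h1
  set M := (k + 1) / 2 with hM
  have hsM := (summable_nat_add_iff M).2 hs
  rw [two_mul_hitProb_one, ← tsum_catalanTerm h0 h1, ← hs.sum_add_tsum_nat_add M,
    sub_add_cancel_left, abs_neg, abs_of_nonneg (tsum_nonneg fun s => catalanTerm_nonneg h0.le _)]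
  have h2 : ∑' s, catalanTerm ρ (s + M) ≤ ∑' s : ℕ, (1 / 2 : ℝ) ^ s * (1 / 2) ^ M := by
    refine hsM.tsum_le_tsum (fun s => ?_) (summable_geometric_two.mul_right _)
    rw [← pow_add]
    exact catalanTerm_le h0.le h1 _
  rw [tsum_mul_right, tsum_geometric_two] at h2
  refine h2.trans (mul_le_mul_of_nonneg_left ?_ two_pos.le)
  calc (1 / 2 : ℝ) ^ M ≤ ((3 / 4) ^ 2) ^ M := by gcongr; norm_num
    _ = (3 / 4) ^ (2 * M) := (pow_mul _ _ _).symm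
    _ ≤ (3 / 4) ^ k := pow_le_pow_of_le_one (by norm_num) (by norm_num) (by omega)

end Catalan

/-! ### Poisson averages -/

section Poisson

/-- The mass that the Poisson law of mean `2 t` gives to `k`. -/
noncomputable def poissonMass (t : ℝ) (k : ℕ) : ℝ :=
  Real.exp (-2 * t) * ((2 * t) ^ k / (k.factorial : ℝ))

theorem poissonMass_nonneg {t : ℝ} (ht : 0 ≤ t) (k : ℕ) : 0 ≤ poissonMass t k := by
  unfold poissonMass; positivity

theorem hasSum_poissonMass_mul_pow (t θ : ℝ) :
    HasSum (fun k => poissonMass t k * θ ^ k) (Real.exp (-2 * t * (1 - θ))) := by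
  have h := (NormedSpace.expSeries_div_hasSum_exp (2 * t * θ)).mul_left (Real.exp (-2 * t))
  rw [← Real.exp_eq_exp_ℝ, ← Real.exp_add] at h
  rw [show -2 * t * (1 - θ) = -2 * t + 2 * t * θ by ring]
  refine h.congr_fun fun k => ?_
  rw [poissonMass, mul_pow (2 * t)]
  ring

theorem hasSum_poissonMass (t : ℝ) : HasSum (poissonMass t) 1 := by
  simpa using hasSum_poissonMass_mul_pow t 1

/-- Multiplying by `k` and shifting the index. -/
theorem hasSum_poissonMass_mul_cast_mul {t a : ℝ} {f : ℕ → ℝ}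
    (h : HasSum (fun k => poissonMass t k * f (k + 1)) a) :
    HasSum (fun k => poissonMass t k * (k * f k)) (2 * t * a) := by
  rw [← hasSum_nat_add_iff' 1]
  simp only [Finset.range_one, Finset.sum_singleton, Nat.cast_zero, zero_mul, mul_zero, sub_zero]
  refine (h.mul_left (2 * t)).congr_fun fun k => ?_
  rw [poissonMass, poissonMass, Nat.factorial_succ, pow_succ]
  push_cast
  field_simp

theorem hasSum_poissonMass_mul_sq (t : ℝ) :
    HasSum (fun k => poissonMass t k * ((k : ℝ) + 3) ^ 2) (4 * t ^ 2 + 14 * t + 9) := by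
  have h1 := hasSum_poissonMass t
  have h2 : HasSum (fun k => poissonMass t k * (k * 1)) (2 * t * 1) :=
    hasSum_poissonMass_mul_cast_mul (f := fun _ => 1) (by simpa using h1)
  have h3 : HasSum (fun k => poissonMass t k * (k * (k - 1))) (2 * t * (2 * t * 1)) :=
    hasSum_poissonMass_mul_cast_mul (f := fun k => (k : ℝ) - 1) (by simpa using h2)
  convert (h3.add (h2.mul_left 7)).add (h1.mul_left 9) using 1
  · funext k; ring
  · ring

end Poisson

/-! ### Meeting probabilities in the configuration model -/

namespace BiDegreeSequence

open VoterModel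

variable {n : ℕ} (d : BiDegreeSequence n)

theorem card_filter_fst_eq (a : Fin n → ℕ) (x : Fin n) :
    (Finset.univ.filter fun p : Σ x, Fin (a x) => p.1 = x).card = a x := by
  rw [Finset.card_filter, Fintype.sum_sigma]
  simp [apply_ite Finset.card]

theorem outDegree_src (x : Fin n) : outDegree d.src x = d.outDeg x :=
  card_filter_fst_eq d.outDeg x

theorem card_outStub : Fintype.card d.OutStub = d.m := by
  simp [OutStub, m]

theorem card_inStub : Fintype.card d.InStub = d.m := by
  simp [InStub, m, d.sum_eq]

theorem nonempty_configuration : Nonempty d.Configuration :=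
  ⟨Fintype.equivOfCardEq (d.card_outStub.trans d.card_inStub.symm)⟩

/-- The expectation over the configuration model, as a conditional expectation given nothing. -/
theorem dcmExpectation_eq_condAvg (F : d.Configuration → ℝ) (ω₀ : d.Configuration) :
    d.dcmExpectation F = condAvg ∅ F ω₀ := by
  simp [dcmExpectation, condAvg, agreeing]

theorem rho_eq_average : d.rho =
    (∑ i : d.InStub, 1 / (outDegree d.src i.1 : ℝ)) / (Fintype.card d.OutStub : ℝ) := by
  rw [card_outStub, rho, Fintype.sum_sigma, one_div_mul_eq_div]
  congr 1
  refine Finset.sum_congr rfl fun x _ => ?_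
  simp [outDegree_src, div_eq_mul_inv]

variable {d} {C C' : ℝ}

theorem DegreesBounded.two_mul_le_m (h : d.DegreesBounded C C') : 2 * n ≤ d.m := by
  have h1 : ∑ _x : Fin n, 2 ≤ d.m := Finset.sum_le_sum fun x _ => (h x).1
  simpa [mul_comm] using h1

theorem DegreesBounded.rho_le_half (h : d.DegreesBounded C C') : d.rho ≤ 1 / 2 := by
  have h1 : ∑ x, (d.inDeg x : ℝ) / (d.outDeg x : ℝ) ≤ 1 / 2 * (d.m : ℝ) := by
    rw [m, ← d.sum_eq, Nat.cast_sum, Finset.mul_sum]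
    refine Finset.sum_le_sum fun x _ => ?_
    have h2 : (2 : ℝ) ≤ d.outDeg x := by exact_mod_cast (h x).1
    rw [div_le_iff₀ (by linarith)]
    nlinarith [(Nat.cast_nonneg (d.inDeg x) : (0 : ℝ) ≤ _)]
  rw [rho, one_div, inv_mul_eq_div]
  exact div_le_of_le_mul₀ (by positivity) (by norm_num) h1

theorem DegreesBounded.rho_pos (h : d.DegreesBounded C C') (hn : 0 < n) : 0 < d.rho := by
  have hm : 0 < d.m := by have := h.two_mul_le_m; omega
  have : Nonempty (Fin n) := ⟨⟨0, hn⟩⟩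
  refine mul_pos (by positivity) (Finset.sum_pos (fun x _ => ?_) Finset.univ_nonempty)
  have h1 : (0 : ℝ) < d.inDeg x := by
    exact_mod_cast (by have := (h x).2.1; omega : 0 < d.inDeg x)
  have h2 : (0 : ℝ) < d.outDeg x := by
    exact_mod_cast (by have := (h x).1; omega : 0 < d.outDeg x)
  positivity

theorem DegreesBounded.one_le_delta (h : d.DegreesBounded C C') (hn : 0 < n) : 1 ≤ d.delta := by
  rw [delta, one_le_div (by exact_mod_cast hn)]
  exact_mod_cast (by have := h.two_mul_le_m; omega : n ≤ d.m)

/-- The probability that the first jump is made along the starting edge, averaged over this edge. -/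
theorem DegreesBounded.sum_one_div_outDegree (h : d.DegreesBounded C C') :
    (∑ e : d.OutStub, 1 / (outDegree d.src (d.src e) : ℝ)) / (d.m : ℝ) = 1 / d.delta := by
  have h1 : ∑ e : d.OutStub, 1 / (outDegree d.src (d.src e) : ℝ) = n := by
    rw [Fintype.sum_sigma]
    simp only [src, outDegree_src]
    have h2 : ∀ x : Fin n, ∑ _i : Fin (d.outDeg x), 1 / (d.outDeg x : ℝ) = 1 := fun x => by
      have : (d.outDeg x : ℝ) ≠ 0 := by
        exact_mod_cast (by have := (h x).1; omega : d.outDeg x ≠ 0)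
      simp [this]
    rw [Finset.sum_congr rfl fun x _ => h2 x]
    simp
  rw [h1, delta, one_div_div]

/-- The annealed probability that the walks started from the ends of a uniform edge have met within
`k` jumps. -/
noncomputable def annealedMeetProb (d : BiDegreeSequence n) (k : ℕ) : ℝ :=
  d.dcmExpectation fun ω => (∑ e, meetProb d.src (tgt ω) k (d.src e) (tgt ω e)) / (d.m : ℝ)

theorem DegreesBounded.abs_annealedMeetProb_sub_le (h : d.DegreesBounded C C') (hn : 0 < n)
    (k : ℕ) :
    |d.annealedMeetProb k - 1 / d.delta * hitProb d.rho k 1| ≤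
      4 * (⌊C'⌋₊ + 1 : ℕ) / d.m * ((k : ℝ) + 3) ^ 2 := by
  set K : ℕ := ⌊C'⌋₊ + 1 with hKdef
  have hK : ∀ x : Fin n, (Finset.univ.filter fun i : d.InStub => i.1 = x).card ≤ K := by
    intro x
    rw [card_filter_fst_eq d.inDeg x]
    exact (Nat.le_floor (h x).2.2.2).trans (Nat.le_succ _)
  have hdeg : ∀ x : Fin n, outDegree d.src x ≠ 0 := fun x => by
    rw [outDegree_src]
    have := (h x).1
    omega
  obtain ⟨ω₀⟩ := d.nonempty_configuration
  have hm2 := h.two_mul_le_m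
  have hm0 : (0 : ℝ) < d.m := by exact_mod_cast (by omega : 0 < d.m)
  have hρ1 : d.rho ≤ 1 := h.rho_le_half.trans (by norm_num)
  have hhit := hitProb_mem_Icc d.rho_nonneg hρ1 k 1
  have hK1 : (1 : ℝ) ≤ K := by exact_mod_cast Nat.succ_le_succ (Nat.zero_le _)
  have hcard : (Fintype.card d.OutStub : ℝ) = d.m := by rw [card_outStub]
  by_cases hk : 2 * (k + 2) ≤ d.m
  · have hedge : ∀ e : d.OutStub, |condAvg ∅ (fun ω : d.Configuration =>
        meetProb d.src (tgt ω) k (d.src e) (tgt ω e)) ω₀ -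
          1 / (outDegree d.src (d.src e) : ℝ) * hitProb d.rho k 1| ≤
        (k + 1) * (4 * K * (k + 2 : ℕ) / d.m) := by
      intro e
      rw [← hcard]
      exact abs_condAvg_meetProb_sub_le (src := d.src) (vert := Sigma.fst) (N := k + 2) hK
        (Nat.succ_le_succ (Nat.zero_le _)) hdeg d.rho_eq_average d.rho_nonneg hρ1
        (by rw [card_outStub]; exact hk) k (D := ∅) (l := []) (f := e) ω₀ (fun _ _ => by simp)
        (by simp)
    have h1 : d.annealedMeetProb k - 1 / d.delta * hitProb d.rho k 1 =
        (∑ e : d.OutStub, (condAvg ∅ (fun ω : d.Configuration =>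
          meetProb d.src (tgt ω) k (d.src e) (tgt ω e)) ω₀ -
            1 / (outDegree d.src (d.src e) : ℝ) * hitProb d.rho k 1)) / d.m := by
      rw [Finset.sum_sub_distrib, ← Finset.sum_mul, sub_div, mul_div_right_comm,
        h.sum_one_div_outDegree, annealedMeetProb, d.dcmExpectation_eq_condAvg _ ω₀]
      simp only [div_eq_inv_mul, condAvg_const_mul, condAvg_sum]
    rw [h1, abs_div, abs_of_pos hm0, div_le_iff₀ hm0]
    refine (Finset.abs_sum_le_sum_abs _ _).trans ((Finset.sum_le_sum fun e _ => hedge e).trans ?_)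
    rw [Finset.sum_const, nsmul_eq_mul, Finset.card_univ, hcard]
    push_cast
    have h2 : (0 : ℝ) ≤ 4 * K / d.m := by positivity
    have h3 : ((k : ℝ) + 1) * (k + 2) ≤ (k + 3) ^ 2 := by
      nlinarith [(Nat.cast_nonneg k : (0 : ℝ) ≤ k)]
    calc (d.m : ℝ) * ((k + 1) * (4 * K * (k + 2) / d.m)) =
          4 * K / d.m * ((k + 1) * (k + 2)) * d.m := by ring
      _ ≤ 4 * K / d.m * (k + 3) ^ 2 * d.m := by gcongr
  · -- the bound is trivial: both quantities are probabilities
    have hδ := h.one_le_delta hn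
    have h1 : 0 ≤ d.annealedMeetProb k ∧ d.annealedMeetProb k ≤ 1 := by
      rw [annealedMeetProb, d.dcmExpectation_eq_condAvg _ ω₀]
      constructor
      · refine (condAvg_const ∅ 0 ω₀).symm.trans_le (condAvg_mono fun ω _ => ?_)
        exact div_nonneg (Finset.sum_nonneg fun e _ => meetProb_nonneg _ _ _) hm0.le
      · refine (condAvg_mono fun ω _ => ?_).trans_eq (condAvg_const ∅ 1 ω₀)
        rw [div_le_one hm0, ← hcard, ← Finset.card_univ, ← nsmul_one, ← Finset.sum_const]
        exact Finset.sum_le_sum fun e _ => meetProb_le_one _ _ _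
    have h2 : 0 ≤ 1 / d.delta * hitProb d.rho k 1 := mul_nonneg (by positivity) hhit.1
    have h3 : 1 / d.delta * hitProb d.rho k 1 ≤ 1 :=
      mul_le_one₀ ((div_le_one (by linarith)).2 hδ) hhit.1 hhit.2
    have h4 : 1 ≤ 4 * K / d.m * ((k : ℝ) + 3) ^ 2 := by
      rw [div_mul_eq_mul_div, one_le_div hm0]
      have h5 : (d.m : ℝ) < 2 * (k + 2) := by exact_mod_cast not_le.1 hk
      nlinarith [(Nat.cast_nonneg k : (0 : ℝ) ≤ k), sq_nonneg ((k : ℝ) + 3)]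
    rw [abs_le]
    constructor <;> linarith

/-! ### Poissonian error bounds and the limit -/

theorem hasSum_annealedDiscordance (h : d.DegreesBounded C C') (hn : 0 < n) (u t : ℝ) :
    HasSum (fun k => poissonMass t k * (2 * u * (1 - u) * (1 - d.annealedMeetProb k)))
      (d.annealedDiscordance u t) := by
  have hm2 := h.two_mul_le_m
  have : Nonempty d.OutStub := Fintype.card_pos_iff.1 (by rw [card_outStub]; omega)
  have hdeg : ∀ x : Fin n, outDegree d.src x ≠ 0 := fun x => by
    rw [outDegree_src]
    have := (h x).1
    omega
  obtain ⟨ω₀⟩ := d.nonempty_configuration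
  have h1 := (hasSum_sum (s := Finset.univ) fun (ω : d.Configuration) _ =>
    hasSum_expectation_discordantDensity (src := d.src) (tgt := tgt ω) hdeg u t).div_const
      (Fintype.card d.Configuration : ℝ)
  refine h1.congr_fun fun k => ?_
  have h2 := d.dcmExpectation_eq_condAvg
    (fun ω => poissonMass t k * (2 * u * (1 - u) * (1 - (∑ e, meetProb d.src (tgt ω) k (d.src e)
      (tgt ω e)) / (d.m : ℝ)))) ω₀
  rw [condAvg_const_mul, condAvg_const_mul, condAvg_sub, condAvg_const,
    ← d.dcmExpectation_eq_condAvg] at h2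
  rw [annealedMeetProb, ← h2, dcmExpectation, card_outStub]
  rfl

theorem DegreesBounded.hasSum_phi (h : d.DegreesBounded C C') {t : ℝ} (ht : 0 ≤ t) :
    HasSum (fun k => poissonMass t k * (1 - 1 / d.delta * hitProb d.rho k 1)) (d.phi t) := by
  have h1 := (d.summable_phi h ht).hasSum.mul_left (1 / (2 * d.delta))
  refine ((hasSum_poissonMass t).sub h1).congr_fun fun k => ?_
  rw [phi_bracket_eq, ← poissonMass]
  field_simp

theorem DegreesBounded.abs_annealedDiscordance_sub_le (h : d.DegreesBounded C C') (hn : 0 < n)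
    {u t : ℝ} (hu0 : 0 ≤ u) (hu1 : u ≤ 1) (ht : 0 ≤ t) :
    |d.annealedDiscordance u t - 2 * u * (1 - u) * d.phi t| ≤
      4 * (⌊C'⌋₊ + 1 : ℕ) / d.m * (4 * t ^ 2 + 14 * t + 9) := by
  have h1 := (hasSum_annealedDiscordance h hn u t).sub
    ((h.hasSum_phi ht).mul_left (2 * u * (1 - u)))
  have h2 := (hasSum_poissonMass_mul_sq t).mul_left (4 * (⌊C'⌋₊ + 1 : ℕ) / (d.m : ℝ))
  rw [← Real.norm_eq_abs]
  refine h1.tsum_eq ▸ tsum_of_norm_bounded h2 fun k => ?_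
  have hu : 0 ≤ 2 * u * (1 - u) := by nlinarith
  have hu' : 2 * u * (1 - u) ≤ 1 := by nlinarith [sq_nonneg (2 * u - 1)]
  have h3 : poissonMass t k * (2 * u * (1 - u) * (1 - d.annealedMeetProb k)) -
      2 * u * (1 - u) * (poissonMass t k * (1 - 1 / d.delta * hitProb d.rho k 1)) =
      -(poissonMass t k * (2 * u * (1 - u) *
        (d.annealedMeetProb k - 1 / d.delta * hitProb d.rho k 1))) := by ring
  rw [h3, norm_neg, Real.norm_eq_abs, abs_mul, abs_mul, abs_of_nonneg hu,
    abs_of_nonneg (poissonMass_nonneg ht k), mul_left_comm (4 * _ / _)]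
  refine mul_le_mul_of_nonneg_left ?_ (poissonMass_nonneg ht k)
  exact (mul_le_of_le_one_left (abs_nonneg _) hu').trans (h.abs_annealedMeetProb_sub_le hn k)

theorem DegreesBounded.abs_phi_sub_phiInfty_le (h : d.DegreesBounded C C') (hn : 0 < n)
    {t : ℝ} (ht : 0 ≤ t) : |d.phi t - d.phiInfty| ≤ Real.exp (-(t / 2)) := by
  have hδ := h.one_le_delta hn
  have hinf : d.phiInfty = 1 - 1 / (2 * d.delta) * (2 * ((1 - √(1 - d.rho)) / d.rho)) := by
    rw [phiInfty]
    field_simp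
  have h1 := (h.hasSum_phi ht).sub ((hasSum_poissonMass t).mul_right d.phiInfty)
  have h2 := hasSum_poissonMass_mul_pow t (3 / 4)
  rw [one_mul] at h1
  rw [← Real.norm_eq_abs, show -(t / 2) = -2 * t * (1 - 3 / 4) by ring]
  refine h1.tsum_eq ▸ tsum_of_norm_bounded h2 fun k => ?_
  have hk := abs_two_mul_hitProb_one_sub_le (h.rho_pos hn) h.rho_le_half k
  have h3 : poissonMass t k * (1 - 1 / d.delta * hitProb d.rho k 1) -
      poissonMass t k * d.phiInfty = -(poissonMass t k * (1 / (2 * d.delta) *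
        (2 * hitProb d.rho k 1 - 2 * ((1 - √(1 - d.rho)) / d.rho)))) := by
    rw [hinf]
    field_simp
    ring
  have h4 : 1 / (2 * d.delta) ≤ 1 / 2 := by
    rw [div_le_div_iff₀ (by linarith) two_pos]
    linarith
  have h5 : 0 ≤ 1 / (2 * d.delta) := by positivity
  rw [h3, norm_neg, Real.norm_eq_abs, abs_mul, abs_mul, abs_of_nonneg h5,
    abs_of_nonneg (poissonMass_nonneg ht k)]
  refine mul_le_mul_of_nonneg_left ?_ (poissonMass_nonneg ht k)
  calc _ ≤ 1 / 2 * (2 * (3 / 4 : ℝ) ^ k) := mul_le_mul h4 hk (abs_nonneg _) (by norm_num)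
    _ = (3 / 4) ^ k := by ring

end BiDegreeSequence

theorem mainTheorem3 (d : (n : ℕ) → BiDegreeSequence n) (C C' : ℝ)
    (hd : ∀ n, (d n).DegreesBounded C C') (u : ℝ) (hu0 : 0 < u) (hu1 : u < 1)
    (t : ℕ → ℝ) (ht0 : ∀ n, 0 ≤ t n)
    (htlim : (∃ l : ℝ, Tendsto t atTop (𝓝 l)) ∨ Tendsto t atTop atTop)
    (htlog : t =o[atTop] fun n : ℕ => Real.log (n : ℝ) ^ 3) :
    Tendsto (fun n => |(d n).annealedDiscordance u (t n) - 2 * u * (1 - u) * (d n).phi (t n)|)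
      atTop (𝓝 0) ∧
    (Tendsto t atTop atTop →
      Tendsto (fun n => |(d n).phi (t n) - (d n).phiInfty|) atTop (𝓝 0)) := by
  constructor
  · have hlog : ∀ j : ℕ, (fun n : ℕ => Real.log (n : ℝ) ^ j) =o[atTop] fun n : ℕ => (n : ℝ) :=
      fun j => (Real.isLittleO_pow_log_id_atTop (n := j)).comp_tendsto tendsto_natCast_atTop_atTop
    have h1 : t =o[atTop] fun n : ℕ => (n : ℝ) := htlog.trans (hlog 3)
    have h2 : (fun n => t n ^ 2) =o[atTop] fun n : ℕ => (n : ℝ) := by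
      refine (htlog.pow two_pos).trans ?_
      simpa only [← pow_mul] using hlog (3 * 2)
    have h3 : (fun n => 4 * t n ^ 2 + 14 * t n + 9) =o[atTop] fun n : ℕ => (n : ℝ) :=
      ((h2.const_mul_left 4).add (h1.const_mul_left 14)).add
        (isLittleO_const_left.2 (Or.inr (by
          simpa [Function.comp_def] using tendsto_natCast_atTop_atTop (R := ℝ))))
    have h4 := h3.tendsto_div_nhds_zero.const_mul (4 * ((⌊C'⌋₊ + 1 : ℕ) : ℝ))
    rw [mul_zero] at h4
    refine squeeze_zero' (Eventually.of_forall fun n => abs_nonneg _) ?_ h4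
    filter_upwards [eventually_gt_atTop 0] with n hn
    refine ((hd n).abs_annealedDiscordance_sub_le hn hu0.le hu1.le (ht0 n)).trans ?_
    have hn' : (0 : ℝ) < n := by exact_mod_cast hn
    have hm : (n : ℝ) ≤ (d n).m := by
      exact_mod_cast (by have := (hd n).two_mul_le_m; omega : n ≤ (d n).m)
    have ht := ht0 n
    rw [div_mul_eq_mul_div, mul_div_assoc]
    gcongr
  · intro htop
    have h1 : Tendsto (fun n => Real.exp (-(t n / 2))) atTop (𝓝 0) :=
      Real.tendsto_exp_neg_atTop_nhds_zero.comp (htop.atTop_div_const two_pos)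
    refine squeeze_zero' (Eventually.of_forall fun n => abs_nonneg _) ?_ h1
    filter_upwards [eventually_gt_atTop 0] with n hn
    exact (hd n).abs_phi_sub_phiInfty_le hn (ht0 n)
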